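/- Let $k$ be an algebraically closed field of any characteristic and let $x_1,\dots,x_r$ be variables. A \emph{basis set} is a finite nonempty set $\beta$ of monomials in $x_1,\dots,x_r$ that contains every divisor of each of its members; put $n=|\beta|$. The monomials not in $\beta$ generate a monomial ideal $I_\beta\subseteq k[x_1,\dots,x_r]$ of colength $n$, which corresponds to a point $t_\beta$ of the Hilbert scheme $\mathrm{Hilb}^n_{\mathbb A^r_k}$; this point lies in the affine open subscheme $U_\beta$ that parametrizes the ideals $I$ for which $\beta$ is a basis of the quotient by $I$. The basis set $\beta$ is called \emph{smooth} if $t_\beta$ is a nonsingular point, i.e. its local ring is regular. For positive integers $w_1,\dots,w_r$ let $$\mathrm{Box}(w_1,\dots,w_r)=\{x_1^{d_1}\cdots x_r^{d_r} : 0\le d_i<w_i,\ 1\le i\le r\}.$$ The $x_i$-width of a basis set $\beta$ is the least $w$ with $x_i^{w}\notin\beta$. A set $\beta'$ is obtained from a basis set $\beta$ with widths $w_1,\dots,w_r$ by \emph{adding a box} in the $x_j$-direction if $\beta'=(x_j^h\cdot\beta)\cup \mathrm{Box}(w_1',\dots,w_{j-1}',h,w_{j+1}',\dots,w_r')$ for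 some $h\ge 1$ and some integers $w_i'\ge w_i$ ($i\ne j$). A \emph{compound box} is a set obtained from a box by finitely many (possibly zero) box additions. (1) For every $r$ and any two boxes $\mathrm{Box}_1,\mathrm{Box}_2$ in $r$ variables, $\beta=\mathrm{Box}_1\cup\mathrm{Box}_2$ is a smooth basis set, and the cotangent space $M/M^2$ of $t_\beta$, where $M$ is the maximal ideal of $t_\beta$ in the coordinate ring of $U_\beta$, has $k$-dimension $r\,|\beta|$. (2) For every $r\ge 4$ there are two boxes in $r$ variables whose union is not a compound box. In particular, for $r=4$, the set $$\{1,\ x_1,\ x_2,\ x_1x_2,\ x_3,\ x_4,\ x_3x_4\}=\mathrm{Box}(2,2,1,1)\cup\mathrm{Box}(1,1,2,2)$$ is not a compound box. -/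

import Mathlib

/-!
Monomials in the variables `x_1, …, x_r` are represented by their exponent vectors `Fin r → ℕ`
(so `x_i` has index `i - 1`), and divisibility of monomials is the componentwise order.
-/

namespace HilbPoints

/-- A basis set: a finite nonempty set of monomials closed under taking divisors. -/
def IsBasisSet {r : ℕ} (β : Finset (Fin r → ℕ)) : Prop :=
  β.Nonempty ∧ ∀ d ∈ β, ∀ e, e ≤ d → e ∈ β

/-- `Box(w_1, …, w_r)`: all monomials whose `x_i`-degree is less than `w_i` for every `i`. -/
def box {r : ℕ} (w : Fin r → ℕ) : Finset (Fin r → ℕ) :=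
  Fintype.piFinset fun i => Finset.range (w i)

/-- The `x_i`-width of `β`: the least exponent `w` such that `x_i ^ w` is not in `β`. -/
noncomputable def width {r : ℕ} (β : Finset (Fin r → ℕ)) (i : Fin r) : ℕ :=
  sInf {w : ℕ | (Pi.single i w : Fin r → ℕ) ∉ β}

/-- `β'` is obtained by adding a box to `β` in the `x_j`-direction: for some `h ≥ 1` and some
`w'_k ≥ x_k`-width of `β` (`k ≠ j`), `β'` is the union of `x_j ^ h · β` and the box with
sides `w'_k` (`k ≠ j`) and `h` (in direction `j`). -/
def IsBoxAddition {r : ℕ} (j : Fin r) (β β' : Finset (Fin r → ℕ)) : Prop :=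
  ∃ (h : ℕ) (w' : Fin r → ℕ), 1 ≤ h ∧ (∀ k, k ≠ j → width β k ≤ w' k) ∧
    β' = β.image (fun m => Pi.single j h + m) ∪ box (Function.update w' j h)

/-- Compound boxes: obtained from a box by finitely many box additions. -/
inductive IsCompoundBox {r : ℕ} : Finset (Fin r → ℕ) → Prop
  | box (w : Fin r → ℕ) (hw : ∀ i, 0 < w i) : IsCompoundBox (box w)
  | add (j : Fin r) (β β' : Finset (Fin r → ℕ)) (hβ : IsCompoundBox β)
      (hadd : IsBoxAddition j β β') : IsCompoundBox β'

/-! ### The affine open neighbourhood `U_β` of `t_β` in the Hilbert scheme of points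

`U_β` parametrizes the ideals `I` such that the monomials in `β` are a basis of the quotient
by `I`.  Its coordinate ring is generated by the coefficients `c^d_j` (`d ∉ β`, `j ∈ β`) of the
congruences `x^d ≡ ∑ j ∈ β, c^d_j x^j`. -/

/-- The arrows of `β`: pairs of a tail `d ∉ β` and a head `j ∈ β`. -/
abbrev Arrow {r : ℕ} (β : Finset (Fin r → ℕ)) : Type :=
  {d : Fin r → ℕ // d ∉ β} × {j : Fin r → ℕ // j ∈ β}

open Classical in
/-- The polynomial `C^b_j`: an indeterminate if `b ∉ β`, and the constant `δ_{bj}` if `b ∈ β`. -/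
noncomputable def coeffPoly (k : Type*) [CommRing k] {r : ℕ} (β : Finset (Fin r → ℕ))
    (b : Fin r → ℕ) (j : {j : Fin r → ℕ // j ∈ β}) : MvPolynomial (Arrow β) k :=
  if h : b ∈ β then (if b = j.1 then 1 else 0) else MvPolynomial.X (⟨b, h⟩, j)

/-- The relation `C^{d'}_{j₀} - ∑_j C^d_j C^{j'}_{j₀}` where the prime denotes multiplication of a
monomial by `x_i`. -/
noncomputable def rel (k : Type*) [CommRing k] {r : ℕ} (β : Finset (Fin r → ℕ))
    (d : Fin r → ℕ) (i : Fin r) (j₀ : {j : Fin r → ℕ // j ∈ β}) : MvPolynomial (Arrow β) k :=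
  coeffPoly k β (d + Pi.single i 1) j₀ -
    ∑ j : {j : Fin r → ℕ // j ∈ β},
      coeffPoly k β d j * coeffPoly k β (j.1 + Pi.single i 1) j₀

/-- The ideal generated by all the relations. -/
noncomputable def relIdeal (k : Type*) [CommRing k] {r : ℕ} (β : Finset (Fin r → ℕ)) :
    Ideal (MvPolynomial (Arrow β) k) :=
  Ideal.span {p | ∃ d i j₀, d ∉ β ∧ p = rel k β d i j₀}

/-- The coordinate ring of `U_β`. -/
abbrev CoordRing (k : Type*) [CommRing k] {r : ℕ} (β : Finset (Fin r → ℕ)) : Type _ :=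
  MvPolynomial (Arrow β) k ⧸ relIdeal k β

/-- The coefficient function `c^b_j` on `U_β`. -/
noncomputable def coeffFun (k : Type*) [CommRing k] {r : ℕ} (β : Finset (Fin r → ℕ))
    (b : Fin r → ℕ) (j : {j : Fin r → ℕ // j ∈ β}) : CoordRing k β :=
  Ideal.Quotient.mk (relIdeal k β) (coeffPoly k β b j)

/-- The ideal `M` of the point `t_β`, the origin of `U_β`: it is generated by the `c^d_j` with
`d ∉ β`. -/
noncomputable def originIdeal (k : Type*) [CommRing k] {r : ℕ} (β : Finset (Fin r → ℕ)) :
    Ideal (CoordRing k β) :=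
  Ideal.span {c | ∃ d j, d ∉ β ∧ c = coeffFun k β d j}

section Origin

variable {k : Type*} [CommRing k] {r : ℕ} {β : Finset (Fin r → ℕ)}

lemma add_single_notMem (hβ : IsBasisSet β) {d : Fin r → ℕ} (hd : d ∉ β) (e : Fin r → ℕ) :
    d + e ∉ β := fun h => hd (hβ.2 _ h _ (by intro i; simp))

lemma aeval_zero_coeffPoly {b : Fin r → ℕ} (hb : b ∉ β) (j : {j : Fin r → ℕ // j ∈ β}) :
    MvPolynomial.aeval (fun _ : Arrow β => (0 : k)) (coeffPoly k β b j) = 0 := by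
  simp [coeffPoly, hb]

/-- Evaluation at the origin `t_β`. -/
noncomputable def originHom (hβ : IsBasisSet β) : CoordRing k β →ₐ[k] k :=
  Ideal.Quotient.liftₐ (relIdeal k β) (MvPolynomial.aeval fun _ => (0 : k)) (by
    intro a ha
    rw [relIdeal] at ha
    have : Ideal.span {p | ∃ d i j₀, d ∉ β ∧ p = rel k β d i j₀} ≤
        RingHom.ker (MvPolynomial.aeval (fun _ : Arrow β => (0 : k))) := by
      rw [Ideal.span_le]
      rintro p ⟨d, i, j₀, hd, rfl⟩
      simp only [SetLike.mem_coe, RingHom.mem_ker, rel, map_sub, map_sum, map_mul]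
      rw [aeval_zero_coeffPoly (add_single_notMem hβ hd _)]
      simp [aeval_zero_coeffPoly hd]
    exact this ha)

lemma ker_originHom (hβ : IsBasisSet β) :
    RingHom.ker (originHom (k := k) hβ) = originIdeal k β := by
  apply le_antisymm
  · intro x hx
    obtain ⟨p, rfl⟩ := Ideal.Quotient.mk_surjective x
    have hp : MvPolynomial.aeval (fun _ : Arrow β => (0 : k)) p = 0 := hx
    have hp' : p ∈ Ideal.span
        ((MvPolynomial.X : Arrow β → MvPolynomial (Arrow β) k) '' Set.univ) := by
      rw [MvPolynomial.mem_ideal_span_X_image]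
      intro m hm
      by_contra! hcon
      have hm0 : m = 0 := by ext a; exact hcon a (Set.mem_univ a)
      rw [MvPolynomial.mem_support_iff, hm0] at hm
      apply hm
      simpa [MvPolynomial.aeval_zero', MvPolynomial.constantCoeff_eq] using hp
    have h2 := Ideal.mem_map_of_mem (Ideal.Quotient.mk (relIdeal k β)) hp'
    rw [Ideal.map_span] at h2
    refine Ideal.span_mono ?_ h2
    rintro _ ⟨_, ⟨⟨d, j⟩, -, rfl⟩, rfl⟩
    exact ⟨d.1, j, d.2, by simp [coeffFun, coeffPoly, d.2]⟩
  · rw [originIdeal, Ideal.span_le]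
    rintro _ ⟨d, j, hd, rfl⟩
    exact aeval_zero_coeffPoly hd j

lemma originIdeal_isPrime [IsDomain k] (hβ : IsBasisSet β) : (originIdeal k β).IsPrime := by
  rw [← ker_originHom hβ]
  exact RingHom.ker_isPrime _

end Origin

/-! ### The functor represented by `CoordRing k β`

The ring constructed above is the coordinate ring of `U_β`: its `A`-valued points are
the ideals `I` of `A[x_1, …, x_r]` such that `β` is an `A`-basis of the quotient by `I`; and the
origin corresponds to the monomial ideal `I_β` generated by the monomials that are not in `β`. -/

section Universal

open MvPolynomial

/-- The monomial `x^d`. -/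
noncomputable def mono (A : Type*) [CommRing A] {r : ℕ} (d : Fin r → ℕ) : MvPolynomial (Fin r) A :=
  monomial (Finsupp.equivFunOnFinite.symm d) 1

/-- The monomials in `β` are an `A`-basis of the quotient of `A[x_1, …, x_r]` by `I`. -/
def IsBasisOfQuotient {A : Type*} [CommRing A] {r : ℕ} (β : Finset (Fin r → ℕ))
    (I : Ideal (MvPolynomial (Fin r) A)) : Prop :=
  LinearIndependent A
      (fun j : {j : Fin r → ℕ // j ∈ β} => (Ideal.Quotient.mkₐ A I) (mono A j.1)) ∧
    ⊤ ≤ Submodule.span A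
      (Set.range fun j : {j : Fin r → ℕ // j ∈ β} => (Ideal.Quotient.mkₐ A I) (mono A j.1))

variable {k : Type*} [CommRing k] {r : ℕ} {β : Finset (Fin r → ℕ)}
  {A : Type*} [CommRing A] [Algebra k A]

/-- The polynomial `F_d = x^d - ∑ j ∈ β, c^d_j x^j` at the point `φ` of `U_β`. -/
noncomputable def univPoly (φ : CoordRing k β →ₐ[k] A) (d : Fin r → ℕ) : MvPolynomial (Fin r) A :=
  mono A d - ∑ j : {j : Fin r → ℕ // j ∈ β}, φ (coeffFun k β d j) • mono A j.1

lemma mono_add_single (d : Fin r → ℕ) (i : Fin r) :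
    mono A (d + Pi.single i 1) = X i * mono A d := by
  have : Finsupp.equivFunOnFinite.symm (d + Pi.single i 1) =
      Finsupp.single i 1 + Finsupp.equivFunOnFinite.symm d := by
    ext a
    simp [add_comm, Finsupp.single_apply, Pi.single_apply, eq_comm]
  rw [mono, this, X, mono, monomial_mul, one_mul]

lemma coeffPoly_mem {b : Fin r → ℕ} (hb : b ∈ β) (j : {j : Fin r → ℕ // j ∈ β}) :
    coeffPoly k β b j = if b = j.1 then 1 else 0 := by
  simp [coeffPoly, hb]

lemma coeffFun_mem {b : Fin r → ℕ} (hb : b ∈ β) (j : {j : Fin r → ℕ // j ∈ β}) :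
    coeffFun k β b j = if b = j.1 then 1 else 0 := by
  rw [coeffFun, coeffPoly_mem hb]
  split_ifs <;> simp

lemma coeffFun_add_single (d : Fin r → ℕ) (i : Fin r) (j₀ : {j : Fin r → ℕ // j ∈ β}) :
    coeffFun k β (d + Pi.single i 1) j₀ =
      ∑ j : {j : Fin r → ℕ // j ∈ β},
        coeffFun k β d j * coeffFun k β (j.1 + Pi.single i 1) j₀ := by
  by_cases hd : d ∈ β
  · rw [Finset.sum_eq_single (⟨d, hd⟩ : {j : Fin r → ℕ // j ∈ β})]
    · simp [coeffFun_mem hd]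
    · intro b _ hb
      rw [coeffFun_mem hd, if_neg, zero_mul]
      rintro rfl
      exact hb rfl
    · simp
  · have h : Ideal.Quotient.mk (relIdeal k β) (rel k β d i j₀) = 0 :=
      Ideal.Quotient.eq_zero_iff_mem.2 (Ideal.subset_span ⟨d, i, j₀, hd, rfl⟩)
    rw [rel, map_sub, sub_eq_zero, map_sum] at h
    simpa [coeffFun] using h

/-- Every ideal with quotient based on `β` is given by a unique point of `U_β`. -/
theorem existsUnique_point (I : Ideal (MvPolynomial (Fin r) A)) (hI : IsBasisOfQuotient β I) :
    ∃! φ : CoordRing k β →ₐ[k] A, ∀ d, univPoly φ d ∈ I := by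
  classical
  let b := Module.Basis.mk hI.1 hI.2
  have hb : ∀ j, b j = Ideal.Quotient.mkₐ A I (mono A j.1) := fun j => by simp [b]
  let c : (Fin r → ℕ) → {j : Fin r → ℕ // j ∈ β} → A :=
    fun d j => b.repr (Ideal.Quotient.mkₐ A I (mono A d)) j
  have hc : ∀ d, Ideal.Quotient.mkₐ A I (mono A d) = ∑ j, c d j • b j :=
    fun d => (b.sum_repr _).symm
  have hcm : ∀ d (hd : d ∈ β) j, c d j = if d = j.1 then 1 else 0 := by
    intro d hd j
    simp only [c]
    rw [← hb ⟨d, hd⟩, b.repr_self, Finsupp.single_apply]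
    simp [Subtype.ext_iff]
  have hev : ∀ d j, aeval (fun a : Arrow β => c a.1.1 a.2) (coeffPoly k β d j) = c d j := by
    intro d j
    by_cases hd : d ∈ β
    · rw [coeffPoly_mem hd, hcm d hd]
      split_ifs <;> simp
    · simp [coeffPoly, hd]
  have hrel : ∀ d i j₀, c (d + Pi.single i 1) j₀ = ∑ j, c d j * c (j.1 + Pi.single i 1) j₀ := by
    intro d i j₀
    have h1 : Ideal.Quotient.mkₐ A I (mono A (d + Pi.single i 1)) =
        ∑ j, c d j • Ideal.Quotient.mkₐ A I (mono A (j.1 + Pi.single i 1)) := by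
      rw [mono_add_single, map_mul, hc d, Finset.mul_sum]
      refine Finset.sum_congr rfl fun j _ => ?_
      rw [mono_add_single, map_mul, hb, mul_smul_comm]
    simp only [c] at h1 ⊢
    conv_lhs => rw [h1]
    simp [map_sum, Finsupp.finsetSum_apply]
  let φ : CoordRing k β →ₐ[k] A :=
    Ideal.Quotient.liftₐ (relIdeal k β) (aeval fun a : Arrow β => c a.1.1 a.2) (by
      have : relIdeal k β ≤ RingHom.ker (aeval (R := k) fun a : Arrow β => c a.1.1 a.2) := by
        rw [relIdeal, Ideal.span_le]
        rintro p ⟨d, i, j₀, hd, rfl⟩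
        simp only [SetLike.mem_coe, RingHom.mem_ker, rel, map_sub, map_sum, map_mul, hev]
        rw [hrel, sub_self]
      exact fun a ha => this ha)
  have hφ : ∀ d j, φ (coeffFun k β d j) = c d j := fun d j => hev d j
  refine ⟨φ, ?_, ?_⟩
  · intro d
    rw [← Ideal.Quotient.eq_zero_iff_mem]
    change Ideal.Quotient.mkₐ A I (univPoly φ d) = 0
    simp only [univPoly, hφ, map_sub, map_sum, map_smul, ← hb]
    rw [hc d, sub_self]
  · intro ψ hψ
    have hψc : ∀ d j, ψ (coeffFun k β d j) = c d j := by
      intro d j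
      have h : Ideal.Quotient.mkₐ A I (univPoly ψ d) = 0 :=
        Ideal.Quotient.eq_zero_iff_mem.2 (hψ d)
      simp only [univPoly, map_sub, map_sum, map_smul, ← hb, sub_eq_zero] at h
      simp only [c, h]
      rw [b.repr_sum_self]
    apply Ideal.Quotient.algHom_ext
    apply MvPolynomial.algHom_ext
    rintro ⟨⟨d, hd⟩, j⟩
    have := (hψc d j).trans (hφ d j).symm
    simpa [coeffFun, coeffPoly, hd] using this

/-- Every point of `U_β` gives a unique ideal with quotient based on `β`. -/
theorem existsUnique_ideal (φ : CoordRing k β →ₐ[k] A) :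
    ∃! I : Ideal (MvPolynomial (Fin r) A), IsBasisOfQuotient β I ∧ ∀ d, univPoly φ d ∈ I := by
  classical
  let L : MvPolynomial (Fin r) A →ₗ[A] ({j : Fin r → ℕ // j ∈ β} → A) :=
    (basisMonomials (Fin r) A).constr A fun d j => φ (coeffFun k β (fun i => d i) j)
  have hL : ∀ d, L (mono A d) = fun j => φ (coeffFun k β d j) := by
    intro d
    have := (basisMonomials (Fin r) A).constr_basis A
      (fun d (j : {j : Fin r → ℕ // j ∈ β}) => φ (coeffFun k β (fun i => d i) j))
      (Finsupp.equivFunOnFinite.symm d)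
    simpa [L, mono] using this
  have hLm : ∀ j : {j : Fin r → ℕ // j ∈ β}, L (mono A j.1) = Pi.single j 1 := by
    intro j
    rw [hL]
    ext j'
    rw [coeffFun_mem j.2]
    by_cases h : j = j'
    · subst h; simp
    · rw [if_neg (fun h' => h (Subtype.ext h')), Pi.single_eq_of_ne (Ne.symm h), map_zero]
  let T : Fin r → ({j : Fin r → ℕ // j ∈ β} → A) →ₗ[A] ({j : Fin r → ℕ // j ∈ β} → A) :=
    fun i => Matrix.toLin' (Matrix.of fun j₀ j => φ (coeffFun k β (j.1 + Pi.single i 1) j₀))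
  have hT : ∀ i f, L (X i * f) = T i (L f) := by
    intro i f
    have : L ∘ₗ LinearMap.mulLeft A (X i) = T i ∘ₗ L := by
      apply (basisMonomials (Fin r) A).ext
      intro e
      obtain ⟨d, rfl⟩ := Finsupp.equivFunOnFinite.symm.surjective e
      have h1 : L (X i * mono A d) = T i (L (mono A d)) := by
        rw [← mono_add_single, hL, hL]
        ext j₀
        simp only [T, Matrix.toLin'_apply, Matrix.mulVec, dotProduct, Matrix.of_apply]
        rw [coeffFun_add_single, map_sum]
        refine Finset.sum_congr rfl fun j _ => ?_
        rw [map_mul, mul_comm]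
      simpa [mono] using h1
    exact LinearMap.congr_fun this f
  have hmul : ∀ g f, L f = 0 → L (g * f) = 0 := by
    intro g
    induction g using MvPolynomial.induction_on with
    | C a => intro f hf; rw [C_mul', map_smul, hf, smul_zero]
    | add p q hp hq => intro f hf; rw [add_mul, map_add, hp f hf, hq f hf, add_zero]
    | mul_X p i hp =>
      intro f hf
      rw [mul_assoc]
      exact hp _ (by rw [hT, hf, map_zero])
  let I : Ideal (MvPolynomial (Fin r) A) :=
    { carrier := {f | L f = 0}
      add_mem' := fun {a b} ha hb => by
        simp only [Set.mem_ofPred_eq] at ha hb ⊢; rw [map_add, ha, hb, add_zero]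
      zero_mem' := map_zero L
      smul_mem' := fun c x hx => hmul c x hx }
  have hImem : ∀ f, f ∈ I ↔ L f = 0 := fun f => Iff.rfl
  have hLsum : ∀ v : {j : Fin r → ℕ // j ∈ β} → A, L (∑ j, v j • mono A j.1) = v := by
    intro v
    simp only [map_sum, map_smul, hLm]
    ext j
    simp [Finset.sum_apply, Pi.single_apply]
  -- reduction of an arbitrary polynomial modulo an ideal containing all `F_d`
  have hred : ∀ J : Ideal (MvPolynomial (Fin r) A), (∀ d, univPoly φ d ∈ J) →
      ∀ f, f - ∑ j, L f j • mono A j.1 ∈ J := by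
    intro J hJ f
    induction f using MvPolynomial.induction_on' with
    | monomial e a =>
      obtain ⟨d, rfl⟩ := Finsupp.equivFunOnFinite.symm.surjective e
      have h := J.mul_mem_left (C a) (hJ d)
      have hC : monomial (Finsupp.equivFunOnFinite.symm d) a = a • mono A d := by
        rw [mono, smul_monomial, smul_eq_mul, mul_one]
      rw [hC, map_smul, hL]
      rw [C_mul', univPoly, smul_sub, Finset.smul_sum] at h
      simpa [smul_smul] using h
    | add p q hp hq =>
      have : p + q - ∑ j, L (p + q) j • mono A j.1 =
          (p - ∑ j, L p j • mono A j.1) + (q - ∑ j, L q j • mono A j.1) := by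
        simp only [map_add, Pi.add_apply, add_smul, Finset.sum_add_distrib]
        ring
      rw [this]
      exact J.add_mem hp hq
  have hF : ∀ d, univPoly φ d ∈ I := by
    intro d
    rw [hImem, univPoly, map_sub, hLsum, hL, sub_self]
  refine ⟨I, ⟨⟨?_, ?_⟩, hF⟩, ?_⟩
  · rw [Fintype.linearIndependent_iff]
    intro g hg
    have h : ∑ j, g j • mono A j.1 ∈ I := by
      rw [← Ideal.Quotient.eq_zero_iff_mem]
      change Ideal.Quotient.mkₐ A I (∑ j, g j • mono A j.1) = 0
      simpa only [map_sum, map_smul] using hg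
    rw [hImem, hLsum] at h
    exact fun j => congrFun h j
  · rintro x -
    obtain ⟨f, rfl⟩ := Ideal.Quotient.mkₐ_surjective A I x
    have h : Ideal.Quotient.mkₐ A I (f - ∑ j, L f j • mono A j.1) = 0 :=
      Ideal.Quotient.eq_zero_iff_mem.2 (hred I hF f)
    rw [map_sub, sub_eq_zero, map_sum] at h
    rw [h]
    refine Submodule.sum_mem _ fun j _ => ?_
    rw [map_smul]
    exact Submodule.smul_mem _ _ (Submodule.subset_span ⟨j, rfl⟩)
  · rintro J ⟨hJ, hJF⟩
    ext f
    rw [hImem]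
    constructor
    · intro hf
      have h1 : ∑ j, L f j • mono A j.1 ∈ J := by
        have := J.sub_mem hf (hred J hJF f)
        simpa using this
      have h2 : Ideal.Quotient.mkₐ A J (∑ j, L f j • mono A j.1) = 0 :=
        Ideal.Quotient.eq_zero_iff_mem.2 h1
      rw [map_sum] at h2
      simp only [map_smul] at h2
      funext j
      exact Fintype.linearIndependent_iff.1 hJ.1 _ h2 j
    · intro hf
      have := hred J hJF f
      simpa [hf] using this

/-- The origin of `U_β` corresponds to the monomial ideal `I_β`. -/
theorem ideal_originHom (hβ : IsBasisSet β) (I : Ideal (MvPolynomial (Fin r) k))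
    (hI : IsBasisOfQuotient β I) (hF : ∀ d, univPoly (originHom (k := k) hβ) d ∈ I) :
    I = Ideal.span {m | ∃ d, d ∉ β ∧ m = mono k d} := by
  classical
  have hsub : Ideal.span {m | ∃ d, d ∉ β ∧ m = mono k d} ≤ I := by
    rw [Ideal.span_le]
    rintro _ ⟨d, hd, rfl⟩
    have h := hF d
    have h0 : ∀ j, originHom (k := k) hβ (coeffFun k β d j) = 0 :=
      fun j => aeval_zero_coeffPoly hd j
    simpa [univPoly, h0] using h
  have hred : ∀ f : MvPolynomial (Fin r) k,
      f - ∑ j : {j : Fin r → ℕ // j ∈ β},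
        coeff (Finsupp.equivFunOnFinite.symm j.1) f • mono k j.1 ∈
        Ideal.span {m | ∃ d, d ∉ β ∧ m = mono k d} := by
    intro f
    induction f using MvPolynomial.induction_on' with
    | monomial e a =>
      obtain ⟨d, rfl⟩ := Finsupp.equivFunOnFinite.symm.surjective e
      have hC : monomial (Finsupp.equivFunOnFinite.symm d) a = a • mono k d := by
        rw [mono, smul_monomial, smul_eq_mul, mul_one]
      simp only [coeff_monomial, EmbeddingLike.apply_eq_iff_eq]
      by_cases hd : d ∈ β
      · rw [Finset.sum_eq_single (⟨d, hd⟩ : {j : Fin r → ℕ // j ∈ β})]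
        · simp [hC]
        · intro b _ hb
          rw [if_neg (fun h => hb (Subtype.ext h.symm)), zero_smul]
        · simp
      · rw [Finset.sum_eq_zero, sub_zero, hC, smul_eq_C_mul]
        · exact Ideal.mul_mem_left _ _ (Ideal.subset_span ⟨d, hd, rfl⟩)
        · intro j _
          rw [if_neg (by rintro rfl; exact hd j.2), zero_smul]
    | add p q hp hq =>
      have := Ideal.add_mem _ hp hq
      simp only [coeff_add, add_smul, Finset.sum_add_distrib]
      convert! this using 1
      ring
  refine le_antisymm (fun f hf => ?_) hsub
  have h1 := I.sub_mem hf (hsub (hred f))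
  rw [sub_sub_cancel] at h1
  have h2 := (Ideal.Quotient.eq_zero_iff_mem).2 h1
  change Ideal.Quotient.mkₐ k I _ = 0 at h2
  simp only [map_sum, map_smul] at h2
  have h3 := Fintype.linearIndependent_iff.1 hI.1 _ h2
  have h4 := hred f
  simpa [h3] using h4

end Universal

/-- `β` is a smooth basis set: it is a basis set and `t_β` is a nonsingular point, i.e. the local
ring at `t_β` of `U_β` (equivalently, of the Hilbert scheme) is a regular local ring. -/
def IsSmoothBasisSet (k : Type*) [Field k] {r : ℕ} (β : Finset (Fin r → ℕ)) : Prop :=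
  ∃ hβ : IsBasisSet β,
    haveI : (originIdeal k β).IsPrime := originIdeal_isPrime hβ
    IsRegularLocalRing (Localization.AtPrime (originIdeal k β))

end HilbPoints

/-! Put n = |β|. Smoothness comes from squeezing the local ring at `t_β` between two bounds: its
dimension is at least rn for every basis set, and for a union of two boxes the cotangent space is
spanned by rn vectors.

The lower bound (`card_mul_le_height_originIdeal`) says that `t_β` is a limit of ideals of n
distinct points. Where the generalized Vandermonde determinant is invertible, interpolation at n
generic points gives a homomorphism φ from the coordinate ring of `U_β`, and the rn point
coordinates are algebraically independent and integral over its image. By Noether normalization and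
going down, every maximal ideal containing ker φ has height at least rn. The origin contains ker φ
because the grids of points with exponents in β, scaled by τ, trace a polynomial curve in `U_β` that
reaches the origin at τ = 0.

The upper bound (`top_le_span_cotangentFamily`) is combinatorial. Modulo M² the relations say that
an arrow may be translated while its tail stays outside β and its head inside, and that it vanishes
if its head can be pushed across a coordinate hyperplane. Hence arrows starting at minimal
generators of `I_β` suffice, and for two boxes they reduce to one arrow for each pair of a direction
and an element of β. `isRegularLocalRing_of_span` combines the bounds.

For the negative part, the last box added in direction j must contain every variable of the set
other than x_j, hence all products of two such variables. This fails for Box(2,2,1,1) ∪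
Box(1,1,2,2), where x_1, x_2 and x_3, x_4 lie in different boxes. -/

namespace HilbPoints

/-! ### Lower bounds for heights of maximal ideals in algebras of finite type. -/

section Dimension

open Cardinal

/-- Since polynomial rings over a field are Jacobson, a maximal ideal contracts to a maximal ideal
when one variable is dropped, and the height drops by exactly one. -/
theorem height_eq_of_isMaximal_mvPolynomial {k : Type*} [Field k] (s : ℕ)
    (P : Ideal (MvPolynomial (Fin s) k)) [hP : P.IsMaximal] : P.height = s := by
  induction s with
  | zero =>
    have e := MvPolynomial.isEmptyRingEquiv k (Fin 0)
    have hF : IsField (MvPolynomial (Fin 0) k) := e.toMulEquiv.isField (Field.toIsField k)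
    let := hF.toField
    rw [(Ideal.eq_bot_or_top P).resolve_right hP.ne_top]
    simp
  | succ s ih =>
    let e := (MvPolynomial.finSuccEquiv k s).toRingEquiv
    have hQ : (P.map e).IsMaximal := Ideal.map_isMaximal_of_equiv e
    have hp : (Ideal.comap Polynomial.C (P.map e)).IsMaximal :=
      Polynomial.isMaximal_comap_C_of_isJacobsonRing _
    have : (P.map e).LiesOver (Ideal.comap Polynomial.C (P.map e)) := ⟨rfl⟩
    rw [← RingEquiv.height_map e P,
      Polynomial.height_eq_height_add_one (Ideal.comap Polynomial.C (P.map e)) (P.map e), ih]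
    push_cast
    rfl

/-- The integral closure of the polynomial ring in `L` is algebraic over it, so it has transcendence
degree `s` over `k`, and it contains the family. -/
theorem card_le_of_isIntegral_mvPolynomial {k L ι : Type*} [Field k] [CommRing L] [IsDomain L]
    [Algebra k L] [Finite ι] (s : ℕ) [Algebra (MvPolynomial (Fin s) k) L]
    [IsScalarTower k (MvPolynomial (Fin s) k) L] [FaithfulSMul (MvPolynomial (Fin s) k) L]
    (x : ι → L) (hx : AlgebraicIndependent k x)
    (hint : ∀ i, IsIntegral (MvPolynomial (Fin s) k) (x i)) : Nat.card ι ≤ s := by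
  let C := integralClosure (MvPolynomial (Fin s) k) L
  let y : ι → C := fun i => ⟨x i, hint i⟩
  have hy : AlgebraicIndependent k y :=
    AlgebraicIndependent.of_comp ((C.restrictScalars k).val) hx
  have h1 := hy.lift_cardinalMk_le_trdeg
  have h2 := lift_trdeg_add_eq k (MvPolynomial (Fin s) k) C
  rw [show Algebra.trdeg (MvPolynomial (Fin s) k) C = 0 from trdeg_eq_zero, MvPolynomial.trdeg_of_isDomain] at h2
  have h3 : Algebra.trdeg k C = s := by
    rw [← Cardinal.lift_inj, ← h2]
    simp
  rw [h3] at h1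
  have := Fintype.ofFinite ι
  simpa using h1

/-- Noether normalization makes `R` integral over a polynomial ring in `s` variables, with `s` at
least the size of the family. The contraction of `M` is maximal of height `s`, and going down lifts
this bound to `M`. -/
theorem card_le_height_of_injective {k R L ι : Type*} [Field k] [CommRing R] [Algebra k R]
    [Algebra.FiniteType k R] [CommRing L] [IsDomain L] [Algebra k L] [Algebra R L]
    [IsScalarTower k R L] [Finite ι] (x : ι → L) (hx : AlgebraicIndependent k x)
    (hint : ∀ i, IsIntegral R (x i)) (hinj : Function.Injective (algebraMap R L))
    (M : Ideal R) [M.IsMaximal] : (Nat.card ι : ℕ∞) ≤ M.height := by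
  have : IsDomain R := hinj.isDomain
  obtain ⟨s, g, hg, hgi⟩ := exists_integral_inj_algHom_of_fg k R
  let : Algebra (MvPolynomial (Fin s) k) R := g.toRingHom.toAlgebra
  let : Algebra (MvPolynomial (Fin s) k) L := ((algebraMap R L).comp g.toRingHom).toAlgebra
  have : IsScalarTower (MvPolynomial (Fin s) k) R L := .of_algebraMap_eq fun _ => rfl
  have : IsScalarTower k (MvPolynomial (Fin s) k) L := .of_algebraMap_eq fun c => by
    rw [IsScalarTower.algebraMap_apply k R L, RingHom.algebraMap_toAlgebra]
    exact congrArg _ (g.commutes c).symm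
  have : FaithfulSMul (MvPolynomial (Fin s) k) R :=
    (faithfulSMul_iff_algebraMap_injective _ _).2 hg
  have : FaithfulSMul (MvPolynomial (Fin s) k) L :=
    (faithfulSMul_iff_algebraMap_injective _ _).2 (hinj.comp hg)
  have : Algebra.IsIntegral (MvPolynomial (Fin s) k) R := ⟨hgi⟩
  have : IsNoetherianRing R := Algebra.FiniteType.isNoetherianRing k R
  have h2 := card_le_of_isIntegral_mvPolynomial s x hx fun i => isIntegral_trans (x i) (hint i)
  have hmax : (M.under (MvPolynomial (Fin s) k)).IsMaximal :=
    Ideal.isMaximal_comap_of_isIntegral_of_isMaximal M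
  rw [Ideal.height_eq_height_add_of_liesOver_of_hasGoingDown
    (M.under (MvPolynomial (Fin s) k)) M, height_eq_of_isMaximal_mvPolynomial]
  exact le_add_right (by exact_mod_cast h2)

theorem height_map_le_of_surjective {R S : Type*} [CommRing R] [CommRing S] {f : R →+* S}
    (hf : Function.Surjective f) (P : Ideal S) [hP : P.IsPrime] :
    P.height ≤ (P.comap f).height := by
  have h := Order.height_le_height_apply_of_strictMono _
    (RingHom.strictMono_comap_of_surjective hf) ⟨P, hP⟩
  rwa [← PrimeSpectrum.height_eq_orderHeight, ← PrimeSpectrum.height_eq_orderHeight] at h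

theorem card_le_height_of_ker_le {k R L ι : Type*} [Field k] [CommRing R] [Algebra k R]
    [Algebra.FiniteType k R] [CommRing L] [IsDomain L] [Algebra k L] [Finite ι] (φ : R →ₐ[k] L)
    (x : ι → L) (hx : AlgebraicIndependent k x) (hint : ∀ i, φ.toRingHom.IsIntegralElem (x i))
    (M : Ideal R) [M.IsMaximal] (hM : RingHom.ker φ ≤ M) : (Nat.card ι : ℕ∞) ≤ M.height := by
  let R' := R ⧸ RingHom.ker φ
  let φ' : R' →ₐ[k] L := Ideal.kerLiftAlg φ
  let : Algebra R' L := φ'.toRingHom.toAlgebra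
  have : IsScalarTower k R' L := .of_algebraMap_eq fun c => (φ'.commutes c).symm
  have hs : Function.Surjective (Ideal.Quotient.mk (RingHom.ker φ)) := Ideal.Quotient.mk_surjective
  have hmax : (M.map (Ideal.Quotient.mk (RingHom.ker φ))).IsMaximal :=
    Ideal.IsMaximal.map_of_surjective_of_ker_le hs (by simpa using hM)
  have h := card_le_height_of_injective (R := R') x hx (fun i => ?_)
    (Ideal.kerLiftAlg_injective φ) (M.map (Ideal.Quotient.mk (RingHom.ker φ)))
  · refine h.trans ((height_map_le_of_surjective hs _).trans (le_of_eq ?_))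
    rw [Ideal.comap_map_of_surjective _ hs, ← RingHom.ker_eq_comap_bot, Ideal.mk_ker,
      sup_eq_left.2 hM]
  · obtain ⟨p, hp, hp'⟩ := hint i
    refine ⟨p.map (Ideal.Quotient.mk _), hp.map _, ?_⟩
    rw [Polynomial.eval₂_map]
    exact hp'

end Dimension

/-! ### Regularity from a spanning family of the cotangent space. -/

section Regularity

variable {k R : Type*} [Field k] [CommRing R] [Algebra k R] [IsNoetherianRing R]

/-- Nakayama: lifts of a spanning family generate `M` modulo its square, hence generate the maximal
ideal after localization. -/
theorem spanFinrank_maximalIdeal_le {ι : Type*} [Fintype ι] (M : Ideal R) [M.IsPrime] (y : ι → M)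
    (hy : ⊤ ≤ Submodule.span k (Set.range fun i => M.toCotangent (y i))) :
    (IsLocalRing.maximalIdeal (Localization.AtPrime M)).spanFinrank ≤ Fintype.card ι := by
  let A := Localization.AtPrime M
  let J : Ideal R := Ideal.span (Set.range fun i => (y i : R))
  have h1 : M ≤ J ⊔ M * M := by
    intro x hx
    have h := hy (Submodule.mem_top (x := M.toCotangent ⟨x, hx⟩))
    rw [Submodule.mem_span_range_iff_exists_fun] at h
    obtain ⟨c, hc⟩ := h
    have h2 : M.toCotangent (∑ i, c i • y i) = M.toCotangent ⟨x, hx⟩ := by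
      rw [← hc, map_sum]
      refine Finset.sum_congr rfl fun i _ => ?_
      rw [← algebraMap_smul R (c i) (y i), map_smul, algebraMap_smul]
    rw [Ideal.toCotangent_eq] at h2
    have h3 : ((∑ i, c i • y i : M) : R) ∈ J := by
      rw [Submodule.coe_sum]
      refine J.sum_mem fun i _ => ?_
      rw [Submodule.coe_smul_of_tower, Algebra.smul_def]
      exact J.mul_mem_left _ (Ideal.subset_span ⟨i, rfl⟩)
    rw [← pow_two]
    have := Ideal.sub_mem (J ⊔ M ^ 2) (Ideal.mem_sup_left h3) (Ideal.mem_sup_right h2)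
    simpa using this
  have h2 : IsLocalRing.maximalIdeal A ≤ J.map (algebraMap R A) := by
    apply Submodule.le_of_le_smul_of_le_jacobson_bot (IsNoetherian.noetherian _)
      (IsLocalRing.maximalIdeal_le_jacobson _)
    have := Ideal.map_mono (f := algebraMap R A) h1
    rwa [Ideal.map_sup, Ideal.map_mul, Localization.AtPrime.map_eq_maximalIdeal] at this
  have h3 : J.map (algebraMap R A) ≤ IsLocalRing.maximalIdeal A := by
    rw [← Localization.AtPrime.map_eq_maximalIdeal]
    apply Ideal.map_mono
    rw [Ideal.span_le]
    rintro _ ⟨i, rfl⟩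
    exact (y i).2
  rw [le_antisymm h2 h3, Ideal.map_span, ← Set.range_comp]
  refine (Submodule.spanFinrank_span_le_ncard_of_finite (Set.finite_range _)).trans ?_
  rw [← Set.image_univ]
  refine (Set.ncard_image_le Set.finite_univ).trans ?_
  simp [Set.ncard_univ]

/-- All terms coincide in the chain card ι ≤ height = dimension ≤ number of generators ≤ dimension
of the cotangent space ≤ card ι. -/
theorem isRegularLocalRing_of_span {ι : Type*} [Fintype ι] (M : Ideal R) [M.IsPrime]
    (v : ι → M.Cotangent) (hv : ⊤ ≤ Submodule.span k (Set.range v))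
    (hM : (Fintype.card ι : ℕ∞) ≤ M.height) :
    IsRegularLocalRing (Localization.AtPrime M) ∧
      Module.finrank k M.Cotangent = Fintype.card ι := by
  have hfin : Module.Finite k M.Cotangent :=
    ⟨⟨(Set.finite_range v).toFinset, by simpa using top_le_iff.1 hv⟩⟩
  have hle : Module.finrank k M.Cotangent ≤ Fintype.card ι := by
    have := finrank_range_le_card (R := k) v
    rwa [Set.finrank, top_le_iff.1 hv, finrank_top] at this
  let b := Module.finBasis k M.Cotangent
  choose y hy using fun i => M.toCotangent_surjective (b i)
  have h1 := spanFinrank_maximalIdeal_le (k := k) M y (by simp [hy, b.span_eq])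
  rw [Fintype.card_fin] at h1
  have h2 := ringKrullDim_le_spanFinrank_maximalIdeal (Localization.AtPrime M)
  have h3 := IsLocalization.AtPrime.ringKrullDim_eq_height M (Localization.AtPrime M)
  have h4 : Fintype.card ι ≤
      (IsLocalRing.maximalIdeal (Localization.AtPrime M)).spanFinrank := by
    rw [h3] at h2
    exact_mod_cast (WithBot.coe_le_coe.2 hM).trans h2
  refine ⟨IsRegularLocalRing.of_spanFinrank_maximalIdeal_le _ ?_, hle.antisymm (h4.trans h1)⟩
  rw [h3]
  refine le_trans ?_ (WithBot.coe_le_coe.2 hM)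
  exact_mod_cast h1.trans hle

end Regularity

/-! ### Points of `U_β` from multivariate interpolation. -/

section Interpolation

/-- The value of the monomial with exponent vector `d` at the point `p`. -/
def monomialAt {A : Type*} [CommRing A] {r : ℕ} (p : Fin r → A) (d : Fin r → ℕ) : A :=
  ∏ i, p i ^ d i

variable {r : ℕ} {β : Finset (Fin r → ℕ)} {A : Type*} [CommRing A]

lemma monomialAt_zero (p : Fin r → A) : monomialAt p 0 = 1 := by simp [monomialAt]

lemma monomialAt_add_single (p : Fin r → A) (d : Fin r → ℕ) (i : Fin r) :
    monomialAt p (d + Pi.single i 1) = monomialAt p d * p i := by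
  simp only [monomialAt, Pi.add_apply, pow_add, Finset.prod_mul_distrib]
  congr 1
  rw [Finset.prod_eq_single i]
  · simp
  · intro t _ ht
    simp [ht]
  · simp

lemma monomialAt_smul (τ : A) (p : Fin r → A) (d : Fin r → ℕ) :
    monomialAt (fun i => τ * p i) d = τ ^ (∑ i, d i) * monomialAt p d := by
  simp [monomialAt, mul_pow, Finset.prod_mul_distrib, Finset.prod_pow_eq_pow_sum]

lemma map_monomialAt {B : Type*} [CommRing B] (f : A →+* B) (p : Fin r → A) (d : Fin r → ℕ) :
    f (monomialAt p d) = monomialAt (fun i => f (p i)) d := by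
  simp [monomialAt]

/-- The generalized Vandermonde matrix of the points `p s` and the monomials in `β`. -/
def vandermondeMatrix (p : {j : Fin r → ℕ // j ∈ β} → Fin r → A) :
    Matrix {j : Fin r → ℕ // j ∈ β} {j : Fin r → ℕ // j ∈ β} A :=
  Matrix.of fun s j => monomialAt (p s) j.1

lemma vandermondeMatrix_mulVec (p : {j : Fin r → ℕ // j ∈ β} → Fin r → A)
    (u : {j : Fin r → ℕ // j ∈ β} → A) (s : {j : Fin r → ℕ // j ∈ β}) :
    (vandermondeMatrix p).mulVec u s = ∑ j, u j * monomialAt (p s) j.1 := by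
  simp [vandermondeMatrix, Matrix.mulVec, dotProduct, mul_comm]

lemma eq_of_interpolation {p : {j : Fin r → ℕ // j ∈ β} → Fin r → A}
    (hp : IsUnit (vandermondeMatrix p).det) {u v : {j : Fin r → ℕ // j ∈ β} → A}
    (h : ∀ s, ∑ j, u j * monomialAt (p s) j.1 = ∑ j, v j * monomialAt (p s) j.1) : u = v := by
  apply Matrix.mulVec_injective_of_isUnit ((Matrix.isUnit_iff_isUnit_det _).2 hp)
  ext s
  simpa only [vandermondeMatrix_mulVec] using h s

/-- The point of `U_β` given by the ideal of a family of points indexed by `β` on which the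
monomials in `β` are independent. -/
theorem exists_interpolationHom (k : Type*) [CommRing k] [Algebra k A]
    {p : {j : Fin r → ℕ // j ∈ β} → Fin r → A} (hp : IsUnit (vandermondeMatrix p).det) :
    ∃ χ : CoordRing k β →ₐ[k] A, ∀ d s,
      ∑ j, χ (coeffFun k β d j) * monomialAt (p s) j.1 = monomialAt (p s) d := by
  classical
  -- The coefficients of the unique combination of monomials in β that agrees with x^d at all the
  -- points.
  let c : (Fin r → ℕ) → {j : Fin r → ℕ // j ∈ β} → A :=
    fun d => (vandermondeMatrix p)⁻¹.mulVec fun s => monomialAt (p s) d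
  have hc : ∀ d s, ∑ j, c d j * monomialAt (p s) j.1 = monomialAt (p s) d := by
    intro d s
    rw [← vandermondeMatrix_mulVec]
    simp only [c]
    rw [Matrix.mulVec_mulVec, Matrix.mul_nonsing_inv _ hp, Matrix.one_mulVec]
  have hcm : ∀ d (hd : d ∈ β) j, c d j = if d = j.1 then 1 else 0 := by
    intro d hd
    refine congrFun (eq_of_interpolation hp fun s => ?_)
    rw [hc, Finset.sum_eq_single ⟨d, hd⟩]
    · simp
    · intro t _ ht
      rw [if_neg (fun h => ht (Subtype.ext h.symm)), zero_mul]
    · simp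
  have hev : ∀ d j, MvPolynomial.aeval (fun x : Arrow β => c x.1.1 x.2) (coeffPoly k β d j) =
      c d j := by
    intro d j
    by_cases hd : d ∈ β
    · rw [coeffPoly_mem hd, hcm d hd]
      split_ifs <;> simp
    · simp [coeffPoly, hd]
  -- By uniqueness it is enough that both sides interpolate the same values, those of x_i x^d.
  have hrel : ∀ d i j₀, c (d + Pi.single i 1) j₀ =
      ∑ j : {j : Fin r → ℕ // j ∈ β}, c d j * c (j.1 + Pi.single i 1) j₀ := by
    intro d i
    refine congrFun (eq_of_interpolation hp fun s => ?_)
    simp only [Finset.sum_mul]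
    rw [Finset.sum_comm, hc, monomialAt_add_single]
    simp only [mul_assoc, ← Finset.mul_sum, hc, monomialAt_add_single]
    simp only [← mul_assoc, ← Finset.sum_mul, hc]
  refine ⟨Ideal.Quotient.liftₐ (relIdeal k β)
    (MvPolynomial.aeval fun x : Arrow β => c x.1.1 x.2) ?_, fun d s => ?_⟩
  · have : relIdeal k β ≤
        RingHom.ker (MvPolynomial.aeval (R := k) fun x : Arrow β => c x.1.1 x.2) := by
      rw [relIdeal, Ideal.span_le]
      rintro _ ⟨d, i, j₀, hd, rfl⟩
      simp only [SetLike.mem_coe, RingHom.mem_ker, rel, map_sub, map_sum, map_mul, hev]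
      rw [hrel, sub_self]
    exact fun x hx => this hx
  · rw [← hc d s]
    exact Finset.sum_congr rfl fun j _ => congrArg (· * _) (hev d j)

end Interpolation

/-! ### Grids of points with exponents in β, and Newton polynomials. -/

section Nodes

variable {k : Type*} [Field k] {r : ℕ} {β : Finset (Fin r → ℕ)}

/-- The value at `x` of the Newton polynomial with nodes `α 0, α 1, …` and exponent `d`. -/
def newton (α : ℕ → k) (d : Fin r → ℕ) (x : Fin r → k) : k :=
  ∏ i, ∏ h ∈ Finset.range (d i), (x i - α h)

lemma newton_eq_zero_iff {α : ℕ → k} (hα : Function.Injective α) (d s : Fin r → ℕ) :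
    newton α d (fun i => α (s i)) = 0 ↔ ¬ d ≤ s := by
  simp only [newton, Finset.prod_eq_zero_iff, Finset.mem_univ, true_and, Finset.mem_range,
    sub_eq_zero, hα.eq_iff, Pi.le_def, not_forall, not_le]
  exact exists_congr fun i => ⟨fun ⟨t, ht, h⟩ => h ▸ ht, fun h => ⟨_, h, rfl⟩⟩

lemma exists_newton_eq (α : ℕ → k) (d : Fin r → ℕ) :
    ∃ c : (Fin r → ℕ) → k, c d = 1 ∧
      ∀ x, newton α d x = ∑ e ∈ Finset.Iic d, c e * monomialAt x e := by
  let P : ℕ → Polynomial k := fun m => ∏ h ∈ Finset.range m, (Polynomial.X - Polynomial.C (α h))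
  have hmonic : ∀ m, (P m).Monic := fun m => Polynomial.monic_prod_X_sub_C _ _
  have hdeg : ∀ m, (P m).natDegree = m := fun m => by
    simp [P]
  refine ⟨fun e => ∏ i, (P (d i)).coeff (e i), ?_, fun x => ?_⟩
  · refine Finset.prod_eq_one fun i _ => ?_
    have := hmonic (d i)
    rw [Polynomial.Monic, Polynomial.leadingCoeff, hdeg] at this
    exact this
  · have h1 : ∀ i, ∏ h ∈ Finset.range (d i), (x i - α h) =
        ∑ t ∈ Finset.range (d i + 1), (P (d i)).coeff t * x i ^ t := by
      intro i
      have := Polynomial.eval_eq_sum_range (p := P (d i)) (x i)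
      rw [hdeg] at this
      rw [← this]
      simp [P, Polynomial.eval_prod]
    have h2 : Finset.Iic d = Fintype.piFinset fun i => Finset.range (d i + 1) := by
      ext e
      simp [Pi.le_def]
    rw [newton, Finset.prod_congr rfl fun i _ => h1 i, Finset.prod_univ_sum, h2]
    exact Finset.sum_congr rfl fun e _ => by rw [Finset.prod_mul_distrib]; rfl

/-- A vector in the left kernel annihilates all monomials in β, hence all Newton polynomials with
exponent in β, since β is closed under divisors. The Newton polynomial of a maximal `m` in the
support of the vector is nonzero at only one support point, `m` itself. -/
lemma det_vandermondeMatrix_ne_zero (hβ : IsBasisSet β) {α : ℕ → k} (hα : Function.Injective α) :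
    (vandermondeMatrix fun (s : {j : Fin r → ℕ // j ∈ β}) i => α (s.1 i)).det ≠ 0 := by
  classical
  intro hdet
  obtain ⟨w, hw, hw0⟩ := Matrix.exists_vecMul_eq_zero_iff.2 hdet
  have h1 : ∀ j ∈ β, ∑ s : {j : Fin r → ℕ // j ∈ β},
      w s * monomialAt (fun i => α (s.1 i)) j = 0 := by
    intro j hj
    simpa [Matrix.vecMul, dotProduct, vandermondeMatrix] using congrFun hw0 ⟨j, hj⟩
  have h2 : ∀ j ∈ β, ∑ s : {j : Fin r → ℕ // j ∈ β},
      w s * newton α j (fun i => α (s.1 i)) = 0 := by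
    intro j hj
    obtain ⟨c, -, hc⟩ := exists_newton_eq α j
    simp only [hc, Finset.mul_sum]
    rw [Finset.sum_comm]
    refine Finset.sum_eq_zero fun e he => ?_
    have := h1 e (hβ.2 _ hj _ (Finset.mem_Iic.1 he))
    simp only [mul_left_comm _ (c e), ← Finset.mul_sum, this, mul_zero]
  have hne : (Finset.univ.filter fun s => w s ≠ 0).Nonempty := by
    obtain ⟨s, hs⟩ := Function.ne_iff.1 hw
    exact ⟨s, by simpa using hs⟩
  obtain ⟨m, hm⟩ := Finset.exists_maximal hne
  have hwm : w m ≠ 0 := (Finset.mem_filter.1 hm.1).2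
  have h3 := h2 m.1 m.2
  rw [Finset.sum_eq_single m] at h3
  · rcases mul_eq_zero.1 h3 with h | h
    · exact hwm h
    · exact (newton_eq_zero_iff hα _ _).1 h le_rfl
  · intro s _ hs
    by_cases hws : w s = 0
    · rw [hws, zero_mul]
    · rw [(newton_eq_zero_iff hα _ _).2, mul_zero]
      intro hle
      exact hs (le_antisymm (hm.2 (by simpa using hws) hle) hle)
  · simp

/-- On the grid of nodes, the coefficients of the interpolation of the monomial `d` by monomials
in `β` vanish at the monomials that do not divide `d`. -/
lemma exists_interpolation_le (hβ : IsBasisSet β) {α : ℕ → k} (hα : Function.Injective α)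
    (d : Fin r → ℕ) :
    ∃ u : {j : Fin r → ℕ // j ∈ β} → k, (∀ j, ¬ j.1 ≤ d → u j = 0) ∧
      ∀ s : {j : Fin r → ℕ // j ∈ β}, ∑ j, u j * monomialAt (fun i => α (s.1 i)) j.1 =
        monomialAt (fun i => α (s.1 i)) d := by
  classical
  induction d using WellFoundedLT.induction with
  | ind d ih =>
  by_cases hd : d ∈ β
  · refine ⟨Pi.single ⟨d, hd⟩ 1, fun j hj => ?_, fun s => ?_⟩
    · rw [Pi.single_eq_of_ne]
      rintro rfl
      exact hj le_rfl
    · simp [Pi.single_apply]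
  -- Since `d ∉ β`, the Newton polynomial of `d` vanishes on the whole grid, so it rewrites x^d
  -- there through proper divisors of x^d, to which induction applies.
  · choose! u hu1 hu2 using ih
    obtain ⟨c, hcd, hc⟩ := exists_newton_eq α d
    refine ⟨fun j => -∑ e ∈ (Finset.Iic d).erase d, c e * u e j, fun j hj => ?_, fun s => ?_⟩
    · rw [neg_eq_zero]
      refine Finset.sum_eq_zero fun e he => ?_
      obtain ⟨hne, hle⟩ := Finset.mem_erase.1 he
      have hle := Finset.mem_Iic.1 hle
      rw [hu1 e (lt_of_le_of_ne hle hne) j (fun h => hj (h.trans hle)), mul_zero]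
    · have h0 : newton α d (fun i => α (s.1 i)) = 0 :=
        (newton_eq_zero_iff hα _ _).2 fun h => hd (hβ.2 _ s.2 _ h)
      rw [hc, ← Finset.add_sum_erase _ _ (Finset.mem_Iic.2 le_rfl), hcd, one_mul] at h0
      rw [eq_neg_of_add_eq_zero_left h0]
      simp only [neg_mul, Finset.sum_neg_distrib, Finset.sum_mul]
      rw [Finset.sum_comm, neg_inj]
      refine Finset.sum_congr rfl fun e he => ?_
      obtain ⟨hne, hle⟩ := Finset.mem_erase.1 he
      rw [← hu2 e (lt_of_le_of_ne (Finset.mem_Iic.1 hle) hne) s, Finset.mul_sum]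
      exact Finset.sum_congr rfl fun j _ => by ring

end Nodes

/-! ### The origin as a limit of ideals of distinct points, and the bound rn for the dimension. -/

section PrincipalComponent

variable {k : Type*} [Field k] {r : ℕ} {β : Finset (Fin r → ℕ)}

lemma IsBasisSet.zero_mem (hβ : IsBasisSet β) : (0 : Fin r → ℕ) ∈ β := by
  obtain ⟨d, hd⟩ := hβ.1
  exact hβ.2 d hd 0 fun _ => Nat.zero_le _

-- The relation for x_i x^d expresses its coefficients through those of x^d and of the products x_i
-- x^j with j in β. Induction on the degree leaves these finitely many generators.
variable (k) in
theorem finiteType_coordRing (hβ : IsBasisSet β) : Algebra.FiniteType k (CoordRing k β) := by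
  classical
  let S : Set (CoordRing k β) := Set.range
    fun x : ({j : Fin r → ℕ // j ∈ β} × Fin r) × {j : Fin r → ℕ // j ∈ β} =>
      coeffFun k β (x.1.1.1 + Pi.single x.1.2 1) x.2
  have hS : ∀ n (d : Fin r → ℕ), ∑ i, d i = n → ∀ j, coeffFun k β d j ∈ Algebra.adjoin k S := by
    intro n
    induction n with
    | zero =>
      intro d hd j
      have : d = 0 := by
        ext i
        simpa using (Finset.sum_eq_zero_iff.1 hd) i (Finset.mem_univ i)
      rw [this, coeffFun_mem hβ.zero_mem]
      split_ifs
      · exact one_mem _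
      · exact zero_mem _
    | succ n ih =>
      intro d hd j
      obtain ⟨i, -, hi⟩ : ∃ i ∈ Finset.univ, d i ≠ 0 := by
        apply Finset.exists_ne_zero_of_sum_ne_zero
        omega
      obtain ⟨d', rfl⟩ : ∃ d', d = d' + Pi.single i 1 := by
        refine ⟨d - Pi.single i 1, (tsub_add_cancel_of_le ?_).symm⟩
        intro t
        by_cases h : t = i
        · subst h; simp; omega
        · simp [h]
      rw [coeffFun_add_single]
      refine Subalgebra.sum_mem _ fun t _ => Subalgebra.mul_mem _ (ih d' ?_ t)
        (Algebra.subset_adjoin ⟨((t, i), j), rfl⟩)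
      simpa [Finset.sum_add_distrib] using hd
  refine ⟨Subalgebra.fg_def.2 ⟨S, Set.finite_range _, top_le_iff.1 ?_⟩⟩
  rintro x -
  obtain ⟨F, rfl⟩ := Ideal.Quotient.mk_surjective x
  induction F using MvPolynomial.induction_on with
  | C c => exact (Algebra.adjoin k S).algebraMap_mem c
  | add p q hp hq => rw [map_add]; exact add_mem hp hq
  | mul_X p a hp =>
    rw [map_mul]
    refine mul_mem hp ?_
    have := hS _ a.1.1 rfl a.2
    rwa [coeffFun, coeffPoly, dif_neg a.1.2] at this

lemma originIdeal_isMaximal (hβ : IsBasisSet β) : (originIdeal k β).IsMaximal := by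
  rw [← ker_originHom hβ]
  exact RingHom.ker_isMaximal_of_surjective _
    fun c => ⟨algebraMap k _ c, (originHom (k := k) hβ).commutes c⟩

/-- Scaling the points by τ makes the coefficients homogeneous of degree |d| − |j|. The truncated
subtraction is harmless because the coefficient is zero unless j ≤ d. -/
lemma interpolationHom_apply (hβ : IsBasisSet β) {α : ℕ → k} (hα : Function.Injective α)
    {u : (Fin r → ℕ) → {j : Fin r → ℕ // j ∈ β} → k} (hu : ∀ d j, ¬ j.1 ≤ d → u d j = 0)
    (hu' : ∀ d (s : {j : Fin r → ℕ // j ∈ β}),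
      ∑ j, u d j * monomialAt (fun i => α (s.1 i)) j.1 = monomialAt (fun i => α (s.1 i)) d)
    {τ : k} (hτ : τ ≠ 0) {χ : CoordRing k β →ₐ[k] k}
    (hχ : ∀ d (s : {j : Fin r → ℕ // j ∈ β}),
      ∑ j, χ (coeffFun k β d j) * monomialAt (fun i => τ * α (s.1 i)) j.1 =
        monomialAt (fun i => τ * α (s.1 i)) d) (d : Fin r → ℕ) (j : {j : Fin r → ℕ // j ∈ β}) :
    χ (coeffFun k β d j) = u d j * τ ^ (∑ i, d i - ∑ i, j.1 i) := by
  have hdet := det_vandermondeMatrix_ne_zero hβ (α := fun n => τ * α n)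
    ((mul_right_injective₀ hτ).comp hα)
  refine congrFun (f := fun j => χ (coeffFun k β d j))
    (g := fun j => u d j * τ ^ (∑ i, d i - ∑ i, j.1 i))
    (eq_of_interpolation hdet.isUnit fun s => ?_) j
  rw [hχ, monomialAt_smul, ← hu', Finset.mul_sum]
  refine Finset.sum_congr rfl fun j _ => ?_
  rw [monomialAt_smul]
  by_cases h : j.1 ≤ d
  · have h1 : ∑ i, j.1 i ≤ ∑ i, d i := Finset.sum_le_sum fun i _ => h i
    rw [← Nat.sub_add_cancel h1, pow_add, Nat.sub_add_cancel h1]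
    ring
  · simp [hu d j h]

/-- A function on `U_β` that vanishes at the ideals of the scaled grids of points with exponents
in `β` vanishes at the origin. -/
lemma mem_originIdeal_of_forall [Infinite k] (hβ : IsBasisSet β) {α : ℕ → k}
    (hα : Function.Injective α) (F : CoordRing k β)
    (hF : ∀ τ : k, τ ≠ 0 → ∀ χ : CoordRing k β →ₐ[k] k,
      (∀ d (s : {j : Fin r → ℕ // j ∈ β}),
        ∑ j, χ (coeffFun k β d j) * monomialAt (fun i => τ * α (s.1 i)) j.1 =
          monomialAt (fun i => τ * α (s.1 i)) d) → χ F = 0) : F ∈ originIdeal k β := by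
  choose u hu hu' using fun d => exists_interpolation_le (β := β) hβ hα d
  obtain ⟨F, rfl⟩ := Ideal.Quotient.mk_surjective F
  -- `F` along the curve of scaled grids: a polynomial in τ, which can therefore be evaluated at τ =
  -- 0 as well.
  let G : Polynomial k := MvPolynomial.aeval (fun x : Arrow β =>
    Polynomial.C (u x.1.1 x.2) * Polynomial.X ^ (∑ i, x.1.1 i - ∑ i, x.2.1 i)) F
  have hG : ∀ τ, G.eval τ = MvPolynomial.aeval (fun x : Arrow β =>
      u x.1.1 x.2 * τ ^ (∑ i, x.1.1 i - ∑ i, x.2.1 i)) F := by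
    intro τ
    have : (Polynomial.aeval τ).comp (MvPolynomial.aeval (R := k) fun x : Arrow β =>
        Polynomial.C (u x.1.1 x.2) * Polynomial.X ^ (∑ i, x.1.1 i - ∑ i, x.2.1 i)) =
        MvPolynomial.aeval (fun x : Arrow β =>
          u x.1.1 x.2 * τ ^ (∑ i, x.1.1 i - ∑ i, x.2.1 i)) := by
      apply MvPolynomial.algHom_ext
      intro x
      simp
    rw [← this]
    simp [G, Polynomial.coe_aeval_eq_eval]
  have h1 : ∀ τ, τ ≠ 0 → G.eval τ = 0 := by
    intro τ hτ
    have hdet := det_vandermondeMatrix_ne_zero hβ (α := fun n => τ * α n)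
      ((mul_right_injective₀ hτ).comp hα)
    obtain ⟨χ, hχ⟩ := exists_interpolationHom k hdet.isUnit
    have h2 := hF τ hτ χ hχ
    have h3 := interpolationHom_apply hβ hα hu hu' hτ hχ
    have h4 : χ.comp (Ideal.Quotient.mkₐ k (relIdeal k β)) = MvPolynomial.aeval
        (fun x : Arrow β => u x.1.1 x.2 * τ ^ (∑ i, x.1.1 i - ∑ i, x.2.1 i)) := by
      apply MvPolynomial.algHom_ext
      intro x
      have := h3 x.1.1 x.2
      rw [coeffFun, coeffPoly, dif_neg x.1.2] at this
      simpa using this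
    rw [hG, ← h4]
    exact h2
  have h0 : G = 0 := by
    apply Polynomial.eq_zero_of_infinite_isRoot
    exact (Set.infinite_univ.sdiff (Set.finite_singleton (0 : k))).mono
      fun τ hτ => h1 τ (by simpa using hτ)
  rw [← ker_originHom hβ, RingHom.mem_ker]
  change MvPolynomial.aeval (fun _ => (0 : k)) F = 0
  -- At τ = 0 every arrow coordinate vanishes: either j does not divide d, or it is a proper divisor
  -- and the exponent of τ is positive. So the curve ends at the origin.
  have h5 : (fun x : Arrow β => u x.1.1 x.2 * (0 : k) ^ (∑ i, x.1.1 i - ∑ i, x.2.1 i)) =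
      fun _ => 0 := by
    ext x
    by_cases h : x.2.1 ≤ x.1.1
    · have hlt : x.2.1 < x.1.1 := lt_of_le_of_ne h fun h' => x.1.2 (h' ▸ x.2.2)
      have : ∑ i, x.2.1 i < ∑ i, x.1.1 i := by
        obtain ⟨h1, i, hi⟩ := Pi.lt_def.1 hlt
        exact Finset.sum_lt_sum (fun i _ => h1 i) ⟨i, Finset.mem_univ i, hi⟩
      rw [zero_pow (by omega), mul_zero]
    · rw [hu _ _ h, zero_mul]
  have h6 := hG 0
  rw [h0, Polynomial.eval_zero, h5] at h6
  exact h6.symm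

variable (k β) in
/-- The Vandermonde determinant of the generic family of points indexed by `β`. -/
noncomputable def genericDet : MvPolynomial ({j : Fin r → ℕ // j ∈ β} × Fin r) k :=
  (vandermondeMatrix fun (s : {j : Fin r → ℕ // j ∈ β}) i => MvPolynomial.X (s, i)).det

lemma map_genericDet {A : Type*} [CommRing A]
    (f : MvPolynomial ({j : Fin r → ℕ // j ∈ β} × Fin r) k →+* A) :
    f (genericDet k β) = (vandermondeMatrix fun (s : {j : Fin r → ℕ // j ∈ β}) i =>
      f (MvPolynomial.X (s, i))).det := by
  rw [genericDet, RingHom.map_det]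
  congr 1
  ext s j
  simp [vandermondeMatrix, map_monomialAt]

theorem card_mul_le_height_originIdeal [Infinite k] (hβ : IsBasisSet β) :
    ((β.card * r : ℕ) : ℕ∞) ≤ (originIdeal k β).height := by
  have := finiteType_coordRing k hβ
  have := originIdeal_isMaximal (k := k) hβ
  let B := MvPolynomial ({j : Fin r → ℕ // j ∈ β} × Fin r) k
  let L := Localization.Away (genericDet k β)
  let α : ℕ → k := Infinite.natEmbedding k
  have hα : Function.Injective α := (Infinite.natEmbedding k).injective
  have hev : ∀ τ : k, τ ≠ 0 → (MvPolynomial.aeval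
      (fun x : {j : Fin r → ℕ // j ∈ β} × Fin r => τ * α (x.1.1 x.2))) (genericDet k β) ≠ 0 := by
    intro τ hτ
    have := map_genericDet (MvPolynomial.aeval (R := k)
      (fun x : {j : Fin r → ℕ // j ∈ β} × Fin r => τ * α (x.1.1 x.2))).toRingHom
    simp only [AlgHom.toRingHom_eq_coe, RingHom.coe_coe, MvPolynomial.aeval_X] at this
    rw [this]
    exact det_vandermondeMatrix_ne_zero hβ (α := fun n => τ * α n)
      ((mul_right_injective₀ hτ).comp hα)
  have hD : genericDet k β ≠ 0 := by
    intro h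
    exact hev 1 one_ne_zero (by rw [h, map_zero])
  have hpow : Submonoid.powers (genericDet k β) ≤ nonZeroDivisors B :=
    powers_le_nonZeroDivisors_of_noZeroDivisors hD
  have : IsDomain L := IsLocalization.isDomain_localization hpow
  let p : {j : Fin r → ℕ // j ∈ β} → Fin r → L := fun s i => algebraMap B L (MvPolynomial.X (s, i))
  have hunit : IsUnit (vandermondeMatrix p).det := by
    rw [← map_genericDet (algebraMap B L)]
    exact IsLocalization.Away.algebraMap_isUnit _
  obtain ⟨φ, hφ⟩ := exists_interpolationHom k hunit
  have hind : AlgebraicIndependent k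
      fun x : {j : Fin r → ℕ // j ∈ β} × Fin r => p x.1 x.2 :=
    (MvPolynomial.algebraicIndependent_X _ k).map' (f := IsScalarTower.toAlgHom k B L)
      (IsLocalization.injective L hpow)
  -- Multiplication by a coordinate of the point `s` preserves the finitely generated module spanned
  -- by the values at `s` of the monomials in β, by the interpolation formula.
  have hint : ∀ x : {j : Fin r → ℕ // j ∈ β} × Fin r,
      φ.toRingHom.IsIntegralElem (p x.1 x.2) := by
    rintro ⟨s, i⟩
    let : Algebra (CoordRing k β) L := φ.toRingHom.toAlgebra
    let N : Submodule (CoordRing k β) L :=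
      Submodule.span _ (Set.range fun j : {j : Fin r → ℕ // j ∈ β} => monomialAt (p s) j.1)
    change IsIntegral (CoordRing k β) (p s i)
    refine isIntegral_of_smul_mem_submodule N ?_ (Submodule.fg_span (Set.finite_range _)) _ ?_
    · rw [Submodule.ne_bot_iff]
      exact ⟨1, Submodule.subset_span ⟨⟨0, hβ.zero_mem⟩, monomialAt_zero _⟩, one_ne_zero⟩
    · intro n hn
      induction hn using Submodule.span_induction with
      | mem y hy =>
        obtain ⟨j, rfl⟩ := hy
        simp only [smul_eq_mul]
        rw [mul_comm, ← monomialAt_add_single, ← hφ]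
        refine N.sum_mem fun t _ => ?_
        exact N.smul_mem (coeffFun k β _ t) (Submodule.subset_span ⟨t, rfl⟩)
      | zero => rw [smul_zero]; exact N.zero_mem
      | add y z _ _ hy hz => rw [smul_add]; exact N.add_mem hy hz
      | smul c y _ hy => rw [smul_comm]; exact N.smul_mem c hy
  -- Each scaled grid specializes the generic points without killing the determinant, so its
  -- homomorphism `χ` factors through `φ` and vanishes on the kernel.
  have hker : RingHom.ker φ ≤ originIdeal k β := by
    intro F hF
    refine mem_originIdeal_of_forall hβ hα F fun τ hτ χ hχ => ?_
    let f : B →ₐ[k] k := MvPolynomial.aeval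
      fun x : {j : Fin r → ℕ // j ∈ β} × Fin r => τ * α (x.1.1 x.2)
    have hf : ∀ y : Submonoid.powers (genericDet k β), IsUnit (f y) := by
      rintro ⟨_, n, rfl⟩
      simp only [map_pow]
      exact (hev τ hτ).isUnit.pow n
    let g : L →ₐ[k] k := IsLocalization.liftAlgHom (M := Submonoid.powers (genericDet k β)) hf
    have hg : ∀ s i, g (p s i) = τ * α (s.1 i) := by
      intro s i
      have : g (algebraMap B L (MvPolynomial.X (s, i))) = f (MvPolynomial.X (s, i)) :=
        IsLocalization.lift_eq _ _
      exact this.trans (MvPolynomial.aeval_X _ _)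
    have hdet := det_vandermondeMatrix_ne_zero hβ (α := fun n => τ * α n)
      ((mul_right_injective₀ hτ).comp hα)
    have h1 : ∀ d j, χ (coeffFun k β d j) = g (φ (coeffFun k β d j)) := by
      intro d
      refine congrFun (eq_of_interpolation hdet.isUnit fun s => ?_)
      rw [hχ]
      have := congrArg g.toRingHom (hφ d s)
      rw [map_sum, map_monomialAt] at this
      simp only [map_mul, map_monomialAt] at this
      simp only [AlgHom.toRingHom_eq_coe, RingHom.coe_coe, hg] at this
      exact this.symm
    have h2 : χ = g.comp φ := by
      apply Ideal.Quotient.algHom_ext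
      apply MvPolynomial.algHom_ext
      intro x
      have := h1 x.1.1 x.2
      rw [coeffFun, coeffPoly, dif_neg x.1.2] at this
      simpa using this
    rw [h2, AlgHom.comp_apply, (RingHom.mem_ker).1 hF, map_zero]
  have := card_le_height_of_ker_le φ _ hind hint (originIdeal k β) hker
  simpa using this

end PrincipalComponent

/-! ### Arrows and their translations in the cotangent space. -/

section CotangentSpace

variable {k : Type*} [Field k] {r : ℕ} {β : Finset (Fin r → ℕ)}

lemma coeffFun_mem_originIdeal {d : Fin r → ℕ} (hd : d ∉ β) (j : {j : Fin r → ℕ // j ∈ β}) :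
    coeffFun k β d j ∈ originIdeal k β :=
  Ideal.subset_span ⟨d, j, hd, rfl⟩

variable (k β) in
open Classical in
/-- The class of the arrow from `d` to `j` in the cotangent space (zero if it is not an arrow). -/
noncomputable def arrowClass (d j : Fin r → ℕ) : (originIdeal k β).Cotangent :=
  if h : d ∉ β ∧ j ∈ β then
    (originIdeal k β).toCotangent ⟨coeffFun k β d ⟨j, h.2⟩, coeffFun_mem_originIdeal h.1 _⟩
  else 0

lemma coeffFun_mul_coeffFun_mem_sq {d : Fin r → ℕ} (hd : d ∉ β) (i : Fin r)
    (j j₀ : {j : Fin r → ℕ // j ∈ β}) (hj : j.1 + Pi.single i 1 ≠ j₀.1) :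
    coeffFun k β d j * coeffFun k β (j.1 + Pi.single i 1) j₀ ∈ originIdeal k β ^ 2 := by
  by_cases h : j.1 + Pi.single i 1 ∈ β
  · simp [coeffFun_mem h, hj]
  · rw [pow_two]
    exact Ideal.mul_mem_mul (coeffFun_mem_originIdeal hd j) (coeffFun_mem_originIdeal h j₀)

/-- Modulo the square of the origin ideal, only the summand whose index times x_i is the new head
survives in the relation. -/
lemma arrowClass_add_single (hβ : IsBasisSet β) {d j : Fin r → ℕ} (hd : d ∉ β) (i : Fin r)
    (hj : j + Pi.single i 1 ∈ β) :
    arrowClass k β (d + Pi.single i 1) (j + Pi.single i 1) = arrowClass k β d j := by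
  classical
  have hj0 : j ∈ β := hβ.2 _ hj _ (by intro t; simp)
  have hd' := add_single_notMem hβ hd (Pi.single i 1)
  rw [arrowClass, arrowClass, dif_pos ⟨hd', hj⟩, dif_pos ⟨hd, hj0⟩, Ideal.toCotangent_eq]
  simp only
  rw [coeffFun_add_single, ← Finset.add_sum_erase _ _ (Finset.mem_univ ⟨j, hj0⟩),
    coeffFun_mem hj, if_pos rfl, mul_one, add_sub_cancel_left]
  refine Ideal.sum_mem _ fun t ht => coeffFun_mul_coeffFun_mem_sq hd i t _ fun h => ?_
  exact (Finset.mem_erase.1 ht).1 (Subtype.ext (add_right_cancel h))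

/-- No index times x_i can equal a head without x_i, so every summand of the relation lies in the
square of the ideal. -/
lemma arrowClass_add_single_eq_zero (hβ : IsBasisSet β) {d j : Fin r → ℕ} (hd : d ∉ β) (i : Fin r)
    (hj : j i = 0) : arrowClass k β (d + Pi.single i 1) j = 0 := by
  classical
  have hd' := add_single_notMem hβ hd (Pi.single i 1)
  by_cases hj0 : j ∈ β
  · rw [arrowClass, dif_pos ⟨hd', hj0⟩, Ideal.toCotangent_eq_zero]
    simp only
    rw [coeffFun_add_single]
    refine Ideal.sum_mem _ fun t ht => coeffFun_mul_coeffFun_mem_sq hd i t _ fun h => ?_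
    have := congrFun h i
    simp [hj] at this
  · simp [arrowClass, hj0]

lemma arrowClass_add (hβ : IsBasisSet β) {d : Fin r → ℕ} (hd : d ∉ β) :
    ∀ (n : ℕ) (j e : Fin r → ℕ), ∑ i, e i = n → j + e ∈ β →
      arrowClass k β (d + e) (j + e) = arrowClass k β d j := by
  intro n
  induction n with
  | zero =>
    intro j e he _
    have : e = 0 := by
      ext i
      simpa using (Finset.sum_eq_zero_iff.1 he) i (Finset.mem_univ i)
    simp [this]
  | succ n ih =>
    intro j e he hj
    obtain ⟨i, -, hi⟩ : ∃ i ∈ Finset.univ, e i ≠ 0 := by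
      apply Finset.exists_ne_zero_of_sum_ne_zero
      omega
    obtain ⟨e', rfl⟩ : ∃ e', e = e' + Pi.single i 1 := by
      refine ⟨e - Pi.single i 1, (tsub_add_cancel_of_le ?_).symm⟩
      intro t
      by_cases h : t = i
      · subst h; simp; omega
      · simp [h]
    have hsum : ∑ t, e' t = n := by
      simpa [Finset.sum_add_distrib] using he
    rw [← add_assoc] at hj
    rw [← add_assoc, ← add_assoc, arrowClass_add_single hβ (add_single_notMem hβ hd _) i hj]
    exact ih j e' hsum (hβ.2 _ hj _ (by intro t; simp))

lemma arrowClass_shift (hβ : IsBasisSet β) {d d' j j' : Fin r → ℕ} (hd : d ∉ β) (hj : j' ∈ β)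
    (hle : d ≤ d') (h : ∀ t, d' t + j t = d t + j' t) :
    arrowClass k β d' j' = arrowClass k β d j := by
  have h1 : d' = d + (d' - d) := (add_tsub_cancel_of_le hle).symm
  have h2 : j' = j + (d' - d) := by
    ext t
    have := h t
    have h3 : d t ≤ d' t := hle t
    simp only [Pi.add_apply, Pi.sub_apply]
    omega
  rw [h2] at hj ⊢
  conv_lhs => rw [h1]
  rw [add_tsub_cancel_left]
  exact arrowClass_add hβ hd _ j _ rfl hj

/-- The arrow can be slid back `j i` steps in direction `i`, bringing its head to the wall, while
its tail keeps one more step to spare above `d`. -/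
lemma arrowClass_eq_zero (hβ : IsBasisSet β) {d d' j : Fin r → ℕ} (hd : d ∉ β) (hj : j ∈ β)
    (hle : d ≤ d') (i : Fin r) (h : d i + j i < d' i) : arrowClass k β d' j = 0 := by
  have h0 : d' = (d' - Pi.single i (j i + 1) + Pi.single i 1) + Pi.single i (j i) := by
    ext t
    by_cases ht : t = i
    · subst ht; simp; omega
    · simp [ht]
  have h1 : d' - Pi.single i (j i + 1) ∉ β := by
    have : d' - Pi.single i (j i + 1) = d + (d' - Pi.single i (j i + 1) - d) := by
      ext t
      have h3 : d t ≤ d' t := hle t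
      by_cases ht : t = i
      · subst ht; simp; omega
      · simp [ht]; omega
    rw [this]
    exact add_single_notMem hβ hd _
  rw [arrowClass_shift hβ (d := d' - Pi.single i (j i + 1) + Pi.single i 1)
    (j := j - Pi.single i (j i)) (add_single_notMem hβ h1 _) hj]
  · exact arrowClass_add_single_eq_zero hβ h1 i (by simp)
  · conv_rhs => rw [h0]
    exact le_self_add
  · intro t
    have := congrFun h0 t
    by_cases ht : t = i
    · subst ht; simp at this ⊢; omega
    · simp [ht]

/-- An arrow whose tail is a multiple of x^d either vanishes or translates to one with tail `d`.
This reduces spanning to arrows starting at generators of the monomial ideal. -/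
lemma arrowClass_mem_of_le (hβ : IsBasisSet β) (W : Submodule k (originIdeal k β).Cotangent)
    {d d' j : Fin r → ℕ} (hd : d ∉ β) (hle : d ≤ d') (hj : j ∈ β)
    (hW : ∀ j ∈ β, arrowClass k β d j ∈ W) : arrowClass k β d' j ∈ W := by
  by_cases h : ∃ i, d i + j i < d' i
  · obtain ⟨i, hi⟩ := h
    rw [arrowClass_eq_zero hβ hd hj hle i hi]
    exact W.zero_mem
  · push Not at h
    rw [arrowClass_shift hβ (j := j - (d' - d)) hd hj hle]
    · exact hW _ (hβ.2 _ hj _ tsub_le_self)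
    · intro t
      have := h t
      have h3 : d t ≤ d' t := hle t
      simp only [Pi.sub_apply]
      omega

lemma smul_cotangent_eq (hβ : IsBasisSet β) (x : CoordRing k β) (v : (originIdeal k β).Cotangent) :
    x • v = originHom (k := k) hβ x • v := by
  have h : x - algebraMap k _ (originHom (k := k) hβ x) ∈ originIdeal k β := by
    rw [← ker_originHom hβ, RingHom.mem_ker]
    simp
  have h2 := (sub_smul x (algebraMap k _ (originHom (k := k) hβ x)) v).symm.trans
    (Ideal.Cotangent.smul_eq_zero_of_mem h v)
  rw [sub_eq_zero] at h2
  rw [h2, algebraMap_smul]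

/-- The coordinate ring acts on the cotangent space through evaluation at the origin, so a
`k`-subspace is already a submodule. -/
lemma top_le_of_arrowClass_mem (hβ : IsBasisSet β)
    (W : Submodule k (originIdeal k β).Cotangent)
    (hW : ∀ d j, d ∉ β → j ∈ β → arrowClass k β d j ∈ W) : ⊤ ≤ W := by
  rintro v -
  obtain ⟨⟨x, hx⟩, rfl⟩ := (originIdeal k β).toCotangent_surjective v
  induction hx using Submodule.span_induction with
  | mem c hc =>
    obtain ⟨d, j, hd, rfl⟩ := hc
    have := hW d j.1 hd j.2
    rwa [arrowClass, dif_pos ⟨hd, j.2⟩] at this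
  | zero =>
    convert W.zero_mem
    rw [Ideal.toCotangent_eq_zero]
    exact zero_mem _
  | add x y hx hy h1 h2 =>
    convert W.add_mem h1 h2
    rw [← map_add]
    rfl
  | smul c x hx h =>
    convert W.smul_mem (originHom (k := k) hβ c) h
    rw [← smul_cotangent_eq hβ, ← map_smul]
    rfl

end CotangentSpace

/-! ### A spanning family of rn arrows for the union of two boxes. -/

section TwoBoxes

variable {k : Type*} [Field k] {r : ℕ} {β : Finset (Fin r → ℕ)} {a b : Fin r → ℕ}

variable (k β a b) in
open Classical in
/-- Representatives of the classes of arrows for the union of the boxes with sides `a` and `b`,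
in a direction `i` with `b i ≤ a i`. -/
noncomputable def sideClass (i : Fin r) (j : Fin r → ℕ) : (originIdeal k β).Cotangent :=
  if h : ∃ p, (∀ t, j t < b t) ∧ j p + a p < b p then
    arrowClass k β (Pi.single i (b i) + Pi.single h.choose (a h.choose))
      (j + Pi.single h.choose (a h.choose))
  else arrowClass k β (Pi.single i (a i)) j

lemma pure_notMem (hab : ∀ d, d ∈ β ↔ (∀ t, d t < a t) ∨ ∀ t, d t < b t) {i : Fin r}
    (hi : b i ≤ a i) : Pi.single i (a i) ∉ β := by
  rw [hab]
  rintro (h | h) <;> have := h i <;> simp at this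
  omega

lemma mixed_notMem (hab : ∀ d, d ∈ β ↔ (∀ t, d t < a t) ∨ ∀ t, d t < b t) (i p : Fin r) :
    Pi.single i (b i) + Pi.single p (a p) ∉ β := by
  rw [hab]
  rintro (h | h)
  · have := h p
    simp at this
  · have := h i
    simp at this

/-- The choice of direction in `sideClass` is immaterial: for two admissible directions `p` and `q`,
both arrows translate to a common one, with head shifted by `a p` in direction `p` and `a q` in
direction `q`. -/
lemma arrowClass_mixed_eq_sideClass (hβ : IsBasisSet β)
    (hab : ∀ d, d ∈ β ↔ (∀ t, d t < a t) ∨ ∀ t, d t < b t) {i p : Fin r}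
    {j : Fin r → ℕ} (hj : ∀ t, j t < b t) (hp : j p + a p < b p) :
    arrowClass k β (Pi.single i (b i) + Pi.single p (a p)) (j + Pi.single p (a p)) =
      sideClass k β a b i j := by
  have hex : ∃ p, (∀ t, j t < b t) ∧ j p + a p < b p := ⟨p, hj, hp⟩
  rw [sideClass, dif_pos hex]
  generalize hq' : hex.choose = q
  have hq : j q + a q < b q := hq' ▸ hex.choose_spec.2
  by_cases hpq : p = q
  · rw [hpq]
  have hmem : j + Pi.single p (a p) + Pi.single q (a q) ∈ β := by
    rw [hab]
    right
    intro t
    have := hj t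
    simp only [Pi.add_apply, Pi.single_apply]
    split_ifs <;> subst_vars <;> first | contradiction | omega
  rw [← arrowClass_shift hβ (j' := j + Pi.single p (a p) + Pi.single q (a q))
      (d' := Pi.single i (b i) + Pi.single p (a p) + Pi.single q (a q))
      (mixed_notMem hab i p) hmem le_self_add (fun t => by simp only [Pi.add_apply]; omega),
    arrowClass_shift hβ (mixed_notMem hab i q) hmem _ _]
  · intro t; simp only [Pi.add_apply]; omega
  · intro t; simp only [Pi.add_apply]; omega

/-- When `sideClass` replaces the pure arrow by a mixed one, shift the pure arrow by `a p` in
direction `p`. Its tail is then a multiple of the mixed generator, and moving back by `a i - b i` in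
direction `i` either kills the arrow or gives a mixed arrow of the family. -/
lemma arrowClass_pure_mem (hβ : IsBasisSet β)
    (hab : ∀ d, d ∈ β ↔ (∀ t, d t < a t) ∨ ∀ t, d t < b t)
    (W : Submodule k (originIdeal k β).Cotangent) {i : Fin r} (hi : b i ≤ a i)
    (hW : ∀ j ∈ β, sideClass k β a b i j ∈ W) {j : Fin r → ℕ} (hj : j ∈ β) :
    arrowClass k β (Pi.single i (a i)) j ∈ W := by
  by_cases hex : ∃ p, (∀ t, j t < b t) ∧ j p + a p < b p
  · obtain ⟨p, hjb, hp⟩ := hex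
    have hpi : p ≠ i := by rintro rfl; omega
    have hmem : j + Pi.single p (a p) ∈ β := by
      rw [hab]
      right
      intro t
      have := hjb t
      simp only [Pi.add_apply, Pi.single_apply]
      split_ifs <;> subst_vars <;> omega
    rw [← arrowClass_shift hβ (j' := j + Pi.single p (a p))
      (d' := Pi.single i (a i) + Pi.single p (a p)) (pure_notMem hab hi) hmem le_self_add
      (fun t => by simp only [Pi.add_apply]; omega)]
    have hle : (Pi.single i (b i) + Pi.single p (a p) : Fin r → ℕ) ≤
        Pi.single i (a i) + Pi.single p (a p) := by
      gcongr
    by_cases hji : j i + b i < a i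
    · rw [arrowClass_eq_zero hβ (mixed_notMem hab i p) hmem hle i (by simp [hpi.symm]; omega)]
      exact W.zero_mem
    · have hj' : j - Pi.single i (a i - b i) ≤ j := tsub_le_self
      rw [arrowClass_shift hβ (j := j - Pi.single i (a i - b i) + Pi.single p (a p))
        (mixed_notMem hab i p) hmem hle, arrowClass_mixed_eq_sideClass hβ hab]
      · exact hW _ (hβ.2 _ hj _ hj')
      · exact fun t => (hj' t).trans_lt (hjb t)
      · have h3 : (j - Pi.single i (a i - b i) : Fin r → ℕ) p ≤ j p := hj' p
        omega
      · intro t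
        simp only [Pi.add_apply, Pi.sub_apply, Pi.single_apply]
        split_ifs <;> subst_vars <;> omega
  · have := hW j hj
    rwa [sideClass, dif_neg hex] at this

/-- If `j p ≥ a p`, the arrow is in the family. Otherwise it can move by `b p - a p` in direction
`p` inside the second box. Its tail becomes a multiple of x_p^(b p) with exponent `b i > j i` in
direction `i`, so the class is zero. -/
lemma arrowClass_mixed_mem_of_lt (hβ : IsBasisSet β)
    (hab : ∀ d, d ∈ β ↔ (∀ t, d t < a t) ∨ ∀ t, d t < b t)
    (W : Submodule k (originIdeal k β).Cotangent) {i p : Fin r} (hi : b i ≤ a i) (hp : a p ≤ b p)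
    (hip : i ≠ p) (hW : ∀ j ∈ β, sideClass k β a b i j ∈ W) {j : Fin r → ℕ}
    (hj : ∀ t, j t < b t) :
    arrowClass k β (Pi.single i (b i) + Pi.single p (a p)) j ∈ W := by
  by_cases hjp : j p < a p
  · have hmem : j + Pi.single p (b p - a p) ∈ β := by
      rw [hab]
      right
      intro t
      have := hj t
      simp only [Pi.add_apply, Pi.single_apply]
      split_ifs <;> subst_vars <;> omega
    have hmem' : Pi.single p (b p) ∉ β := pure_notMem (fun d => (hab d).trans or_comm) hp
    have := hj i
    rw [← arrowClass_shift hβ (j' := j + Pi.single p (b p - a p))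
      (d' := Pi.single i (b i) + Pi.single p (b p)) (mixed_notMem hab i p) hmem (by gcongr) _,
      arrowClass_eq_zero hβ hmem' hmem le_add_self i (by simpa [hip])]
    · exact W.zero_mem
    · intro t
      simp only [Pi.add_apply, Pi.single_apply]
      split_ifs <;> subst_vars <;> omega
  · have hle : Pi.single p (a p) ≤ j := by
      intro t
      simp only [Pi.single_apply]
      split_ifs <;> subst_vars <;> omega
    obtain ⟨u, rfl⟩ : ∃ u, j = u + Pi.single p (a p) :=
      ⟨j - Pi.single p (a p), (tsub_add_cancel_of_le hle).symm⟩
    have hu : ∀ t, u t < b t := fun t => lt_of_le_of_lt (by simp) (hj t)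
    rw [arrowClass_mixed_eq_sideClass hβ hab hu (by simpa using hj p)]
    exact hW _ ((hab u).2 (Or.inr hu))

lemma arrowClass_mem (hβ : IsBasisSet β)
    (hab : ∀ d, d ∈ β ↔ (∀ t, d t < a t) ∨ ∀ t, d t < b t)
    (W : Submodule k (originIdeal k β).Cotangent)
    (hW : ∀ i, ∀ j ∈ β, b i < a i → sideClass k β a b i j ∈ W)
    (hW' : ∀ i, ∀ j ∈ β, a i ≤ b i → sideClass k β b a i j ∈ W) (d j : Fin r → ℕ)
    (hd : d ∉ β) (hj : j ∈ β) : arrowClass k β d j ∈ W := by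
  have hba : ∀ d, d ∈ β ↔ (∀ t, d t < b t) ∨ ∀ t, d t < a t := fun d => (hab d).trans or_comm
  have single_le : ∀ (i : Fin r) (c : ℕ), c ≤ d i → Pi.single i c ≤ d := by
    intro i c hc t
    simp only [Pi.single_apply]
    split_ifs <;> subst_vars <;> omega
  have hd' := hd
  rw [hab] at hd'
  push Not at hd'
  -- A monomial outside β is divisible by a pure power lying outside both boxes or, failing that, by
  -- a mixed generator. For the latter, heads in either box are treated by exchanging the roles of
  -- the boxes.
  obtain ⟨⟨i, hi⟩, l, hl⟩ := hd'
  by_cases h1 : b i < a i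
  · exact arrowClass_mem_of_le hβ W (pure_notMem hab h1.le) (single_le i _ hi) hj
      fun j hj => arrowClass_pure_mem hβ hab W h1.le (fun j hj => hW i j hj h1) hj
  by_cases h2 : a l ≤ b l
  · exact arrowClass_mem_of_le hβ W (pure_notMem hba h2) (single_le l _ hl) hj
      fun j hj => arrowClass_pure_mem hβ hba W h2 (fun j hj => hW' l j hj h2) hj
  push Not at h1 h2
  have hli : l ≠ i := by rintro rfl; omega
  refine arrowClass_mem_of_le hβ W (mixed_notMem hab l i) ?_ hj fun j hj => ?_
  · intro t
    simp only [Pi.add_apply, Pi.single_apply]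
    split_ifs <;> subst_vars <;> first | contradiction | omega
  rcases (hab j).1 hj with h | h
  · rw [add_comm]
    exact arrowClass_mixed_mem_of_lt hβ hba W h1 h2.le hli.symm (fun j hj => hW' i j hj h1) h
  · exact arrowClass_mixed_mem_of_lt hβ hab W h2.le h1 hli (fun j hj => hW l j hj h2) h

variable (k β a b) in
open Classical in
/-- A spanning family of the cotangent space at the union of the boxes with sides `a` and `b`. -/
noncomputable def cotangentFamily (x : Fin r × {j : Fin r → ℕ // j ∈ β}) :
    (originIdeal k β).Cotangent :=
  if b x.1 < a x.1 then sideClass k β a b x.1 x.2 else sideClass k β b a x.1 x.2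

theorem top_le_span_cotangentFamily (hβ : IsBasisSet β)
    (hab : ∀ d, d ∈ β ↔ (∀ t, d t < a t) ∨ ∀ t, d t < b t) :
    ⊤ ≤ Submodule.span k (Set.range (cotangentFamily k β a b)) := by
  refine top_le_of_arrowClass_mem hβ _ (arrowClass_mem hβ hab _ ?_ ?_)
  · intro i j hj h
    exact Submodule.subset_span ⟨(i, ⟨j, hj⟩), by simp [cotangentFamily, h]⟩
  · intro i j hj h
    exact Submodule.subset_span ⟨(i, ⟨j, hj⟩), by simp [cotangentFamily, h.not_gt]⟩

end TwoBoxes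

/-! ### Unions of two boxes: smoothness, and failure to be a compound box. -/

section Boxes

variable {r : ℕ}

lemma mem_box {w d : Fin r → ℕ} : d ∈ box w ↔ ∀ i, d i < w i := by
  simp [box]

lemma mem_box_union {a b d : Fin r → ℕ} :
    d ∈ box a ∪ box b ↔ (∀ t, d t < a t) ∨ ∀ t, d t < b t := by
  rw [Finset.mem_union, mem_box, mem_box]

lemma isBasisSet_box_union {a : Fin r → ℕ} (b : Fin r → ℕ) (ha : ∀ i, 0 < a i) :
    IsBasisSet (box a ∪ box b) := by
  refine ⟨⟨0, mem_box_union.2 (Or.inl ha)⟩, fun d hd e he => ?_⟩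
  rw [mem_box_union] at hd ⊢
  exact hd.imp (fun h t => (he t).trans_lt (h t)) fun h t => (he t).trans_lt (h t)

theorem isSmoothBasisSet_box_union (k : Type*) [Field k] [Infinite k] {a : Fin r → ℕ}
    (b : Fin r → ℕ) (ha : ∀ i, 0 < a i) :
    IsSmoothBasisSet k (box a ∪ box b) ∧
      Module.finrank k (originIdeal k (box a ∪ box b)).Cotangent = r * (box a ∪ box b).card := by
  have hβ := isBasisSet_box_union b ha
  have := originIdeal_isPrime (k := k) hβ
  have := finiteType_coordRing k hβ
  have : IsNoetherianRing (CoordRing k (box a ∪ box b)) :=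
    Algebra.FiniteType.isNoetherianRing k _
  have hcard : Fintype.card (Fin r × {j : Fin r → ℕ // j ∈ box a ∪ box b}) =
      r * (box a ∪ box b).card := by simp
  have h := isRegularLocalRing_of_span (originIdeal k (box a ∪ box b))
    (cotangentFamily k (box a ∪ box b) a b)
    (top_le_span_cotangentFamily hβ fun _ => mem_box_union) (by
      rw [hcard, mul_comm]
      exact card_mul_le_height_originIdeal hβ)
  exact ⟨⟨hβ, h.1⟩, h.2.trans hcard⟩

lemma single_add_single_mem_box {w : Fin r → ℕ} {p q : Fin r} (hpq : p ≠ q)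
    (hp : Pi.single p 1 ∈ box w) (hq : Pi.single q 1 ∈ box w) :
    Pi.single p 1 + Pi.single q 1 ∈ box w := by
  rw [mem_box] at *
  intro t
  have h1 := hp t
  have h2 := hq t
  by_cases h : t = p
  · subst h
    simpa [hpq] using h1
  · simpa [h] using h2

/-- If, whatever variable is left out, `β` contains two other variables but not their product,
then `β` is not a compound box. -/
theorem not_isCompoundBox_of_forall {β : Finset (Fin r → ℕ)} (j₀ : Fin r)
    (h : ∀ j : Fin r, ∃ p q : Fin r, p ≠ q ∧ p ≠ j ∧ q ≠ j ∧ Pi.single p 1 ∈ β ∧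
      Pi.single q 1 ∈ β ∧ Pi.single p 1 + Pi.single q 1 ∉ β) : ¬ IsCompoundBox β := by
  rintro (⟨w, hw⟩ | ⟨j, β₀, _, -, n, w, hn, -, rfl⟩)
  · obtain ⟨p, q, hpq, -, -, hp, hq, hn⟩ := h j₀
    exact hn (single_add_single_mem_box hpq hp hq)
  · obtain ⟨p, q, hpq, hpj, hqj, hp, hq, hmem⟩ := h j
    -- The translated copy of `β₀` has degree at least `n ≥ 1` in direction `j`, so every other
    -- variable must come from the added box.
    have key : ∀ t, t ≠ j → Pi.single t 1 ∈ β₀.image (fun m => Pi.single j n + m) ∪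
        box (Function.update w j n) → Pi.single t 1 ∈ box (Function.update w j n) := by
      intro t ht hmem
      refine (Finset.mem_union.1 hmem).resolve_left fun h => ?_
      obtain ⟨m, -, hm⟩ := Finset.mem_image.1 h
      have := congrFun hm j
      simp [ht.symm] at this
      omega
    exact hmem (Finset.mem_union_right _
      (single_add_single_mem_box hpq (key p hpj hp) (key q hqj hq)))

theorem not_isCompoundBox_box_union (hr : 4 ≤ r) {a b : Fin r → ℕ}
    (ha : a = fun i => if i.1 < 2 then 2 else 1)
    (hb : b = fun i => if 2 ≤ i.1 ∧ i.1 < 4 then 2 else 1) :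
    ¬ IsCompoundBox (box a ∪ box b) := by
  subst ha hb
  refine not_isCompoundBox_of_forall ⟨0, by omega⟩ fun j => ?_
  -- Each of the pairs {x_1, x_2} and {x_3, x_4} retains a variable when x_j is left out, and the
  -- product of one from each lies in neither box.
  obtain ⟨p, hp, hpj⟩ : ∃ p : Fin r, p.1 < 2 ∧ p ≠ j := by
    by_cases h : j.1 = 0
    · exact ⟨⟨1, by omega⟩, by simp, fun h' => by simp [← h'] at h⟩
    · exact ⟨⟨0, by omega⟩, by simp, fun h' => h (by simp [← h'])⟩
  obtain ⟨q, hq2, hq4, hqj⟩ : ∃ q : Fin r, 2 ≤ q.1 ∧ q.1 < 4 ∧ q ≠ j := by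
    by_cases h : j.1 = 2
    · exact ⟨⟨3, by omega⟩, by simp, by simp, fun h' => by simp [← h'] at h⟩
    · exact ⟨⟨2, by omega⟩, by simp, by simp, fun h' => h (by simp [← h'])⟩
  have hpq : p ≠ q := by rintro rfl; omega
  refine ⟨p, q, hpq, hpj, hqj, ?_, ?_, ?_⟩
  · refine mem_box_union.2 (Or.inl fun t => ?_)
    by_cases h : t = p
    · subst h; simp [hp]
    · simp only [Pi.single_eq_of_ne h]; positivity
  · refine mem_box_union.2 (Or.inr fun t => ?_)
    by_cases h : t = q
    · subst h; simp [hq2, hq4]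
    · simp only [Pi.single_eq_of_ne h]; positivity
  · rw [mem_box_union]
    rintro (h | h)
    · have := h q
      simp [hpq.symm, not_lt.2 hq2] at this
    · have := h p
      simp [hpq, not_le.2 hp] at this

lemma box_union_eq : box ![2, 2, 1, 1] ∪ box ![1, 1, 2, 2] =
    ({![0, 0, 0, 0], ![1, 0, 0, 0], ![0, 1, 0, 0], ![1, 1, 0, 0],
      ![0, 0, 1, 0], ![0, 0, 0, 1], ![0, 0, 1, 1]} : Finset (Fin 4 → ℕ)) := by
  decide

end Boxes

end HilbPoints

theorem mainTheorem8 (k : Type*) [Field k] [IsAlgClosed k] :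
    (∀ (r : ℕ) (w₁ w₂ : Fin r → ℕ), (∀ i, 0 < w₁ i) → (∀ i, 0 < w₂ i) →
      HilbPoints.IsSmoothBasisSet k (HilbPoints.box w₁ ∪ HilbPoints.box w₂) ∧
      Module.finrank k
          (HilbPoints.originIdeal k (HilbPoints.box w₁ ∪ HilbPoints.box w₂)).Cotangent =
        r * (HilbPoints.box w₁ ∪ HilbPoints.box w₂).card) ∧
    (∀ r : ℕ, 4 ≤ r → ∃ w₁ w₂ : Fin r → ℕ, (∀ i, 0 < w₁ i) ∧ (∀ i, 0 < w₂ i) ∧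
      ¬ HilbPoints.IsCompoundBox (HilbPoints.box w₁ ∪ HilbPoints.box w₂)) ∧
    (HilbPoints.box ![2, 2, 1, 1] ∪ HilbPoints.box ![1, 1, 2, 2] =
        {![0, 0, 0, 0], ![1, 0, 0, 0], ![0, 1, 0, 0], ![1, 1, 0, 0],
          ![0, 0, 1, 0], ![0, 0, 0, 1], ![0, 0, 1, 1]} ∧
      ¬ HilbPoints.IsCompoundBox
        ({![0, 0, 0, 0], ![1, 0, 0, 0], ![0, 1, 0, 0], ![1, 1, 0, 0],
          ![0, 0, 1, 0], ![0, 0, 0, 1], ![0, 0, 1, 1]} : Finset (Fin 4 → ℕ))) := by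
  have : Infinite k := IsAlgClosed.instInfinite
  refine ⟨fun r w₁ w₂ h₁ _ => HilbPoints.isSmoothBasisSet_box_union k w₂ h₁, fun r hr => ?_,
    HilbPoints.box_union_eq, ?_⟩
  · exact ⟨_, _, fun i => by positivity, fun i => by positivity,
      HilbPoints.not_isCompoundBox_box_union hr rfl rfl⟩
  · rw [← HilbPoints.box_union_eq]
    refine HilbPoints.not_isCompoundBox_box_union le_rfl ?_ ?_ <;>
    · ext i
      fin_cases i <;> rfl
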